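/- **Setting.** Let $1\le k\le N$ and $T\ge 2$ be integers, let $\ell_t\in[0,1]^N$ ($1\le t\le T$) be an arbitrary loss sequence fixed in advance, and let $a\in[0,1]^N$. In round $t$ a random set $S_t\subseteq[N]$ of available arms is drawn, independently over rounds; arm $i$ belongs to $S_t$ with probability $a_i$, independently of the other arms, so that $S$ is drawn with probability $P_a(S)=\prod_{i\in S}a_i\prod_{i\notin S}(1-a_i)$. The learner sees $S_t$, plays a set $\Omega_t\subseteq S_t$ of $k$ arms, and observes $\ell_t(i)$ for $i\in\Omega_t$. (If $|S_t|<k$, all arms of $S_t$ are played.) **Scaled probabilities.** For positive weights $w$ and $S\subseteq[N]$ put $p(i)=w(i)/\sum_{j\in S}w(j)$ for $i\in S$ and $p(i)=0$ otherwise. If $\max_{i\in S} p(i)\ge 1/k$, replace $p$ by its capped version: for the least $m\ge1$ for which no entry of the result exceeds $1/k$, set the $m$ largest entries to $1/k$ and rescale the others to total mass $(k-m)/k$ (with $0/0=0$). Let $q^S(i)=k\,p(i)$ for $i\in S$ and $q^S(i)=0$ for $i\notin S$. **Mixture decomposition.** A vector $p\in[0,1]^N$ with $\sum_i p(i)=k$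 is written as $p=\sum_{\Omega}q_\Omega\mathbf 1_\Omega$, a convex combination over $k$-subsets, as follows. While $p$ has a positive entry, let $c=\frac1k\sum_i p(i)$, choose any $k$-set $r$ of nonzero components of $p$ that contains all $i$ with $p(i)=c$, let $s=\min_{i\in r}p(i)$ and $l=\max_{i\notin r}p(i)$ ($l=0$ if $r=[N]$), add $\min(s,c-l)$ to the coefficient $q_r$, and replace $p$ by $p-\min(s,c-l)\mathbf 1_r$. The choices of $r$ are made by an arbitrary fixed rule depending on the input vector. **Algorithm.** Start with $w_1(i)=1$ for all $i$. In round $t$, let $q_t^S$ be the scaled probabilities for the weights $w_t$; observe $S_t$; decompose $q_t^{S_t}=\sum_\Omega q_\Omega\mathbf 1_\Omega$ as above and play $\Omega_t=\Omega$ with probability $q_\Omega$; then set, for all $i\in[N]$, $$\hat a_t(i)=\frac1t\sum_{j=1}^t\mathbf 1(i\in S_j),\qquad \hat q_t(i)=\sum_{S\subseteq[N]}P_{\hat a_t}(S)\,q_t^S(i),$$ $$\hat\ell_t(i)=\frac{\ell_t(i)}{\hat q_t(i)+\lambda_t}\mathbf 1(i\in\Omega_t),\qquad w_{t+1}(i)=w_t(i)\,e^{-\eta\hat\ell_t(i)}.$$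 The parameters are $\delta=N/T^2$, $\eta=\sqrt{\ln(N/k)/(NT)}$ and $$\lambda_t=\min\Big\{1,\;2kN\sqrt{\tfrac{2\log(N/\delta)}{t}}+\tfrac{8kN\log(N/\delta)}{3t}\Big\}.$$ **Theorem.** There is an absolute constant $C>0$ such that, for all $N,k,T,a,\ell$ as above and all choice rules in the decomposition, the algorithm satisfies $$R_T=\max_{\pi}\ \mathbb E\Big[\sum_{t=1}^T\sum_{i\in\Omega_t}\ell_t(i)-\sum_{t=1}^T\sum_{i\in\pi(S_t)}\ell_t(i)\Big]\le C\,kN^2\sqrt{T\log T},$$ where $\pi$ ranges over the maps that assign to every $S\subseteq[N]$ a set $\pi(S)\subseteq S$ with $|\pi(S)|=\min(k,|S|)$, and the expectation is over the availabilities and the randomness of the algorithm. -/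

import Mathlib

/-! Sleeping bandit with multiple plays: arms are `Fin N`, rounds are numbered `1, …, T`. -/

namespace SleepingBandit

noncomputable section

/-! ### Capped probabilities -/

/-- The weights `w` restricted to the available set `S` and normalised. -/
def normalized {N : ℕ} (S : Finset (Fin N)) (w : Fin N → ℝ) (i : Fin N) : ℝ :=
  if i ∈ S then w i / ∑ j ∈ S, w j else 0

/-- Position (counted from `0`) of arm `j` when `p` is listed in decreasing order; ties are
broken by the index of the arm. -/
def position {N : ℕ} (p : Fin N → ℝ) (j : Fin N) : ℕ :=
  (Finset.univ.filter fun m => p j < p m ∨ (p m = p j ∧ m < j)).card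

/-- The vector formed in pass `i` of the capping loop: the `i` largest entries of `p` are set to
`1 / k`, the other ones are rescaled to the total mass `(k - i) / k`. -/
def capTop {N : ℕ} (k : ℕ) (p : Fin N → ℝ) (i : ℕ) (j : Fin N) : ℝ :=
  if position p j < i then 1 / (k : ℝ)
  else ((k : ℝ) - i) / k * (p j / ∑ l with i ≤ position p l, p l)

/-- The pass in which the capping loop stops: the first `i ≥ 1` for which no entry exceeds
`1 / k`. -/
def capStop {N : ℕ} (k : ℕ) (p : Fin N → ℝ) : ℕ :=
  sInf {i : ℕ | 1 ≤ i ∧ ∀ j, capTop k p i j ≤ 1 / (k : ℝ)}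

/-- The capping loop stops. -/
theorem capStop_spec {N : ℕ} (k : ℕ) (p : Fin N → ℝ) :
    1 ≤ capStop k p ∧ ∀ j, capTop k p (capStop k p) j ≤ 1 / (k : ℝ) := by
  refine Nat.sInf_mem (s := {i : ℕ | 1 ≤ i ∧ ∀ j, capTop k p i j ≤ 1 / (k : ℝ)})
    ⟨N + 1, by omega, fun j => ?_⟩
  have h : position p j < N + 1 :=
    Nat.lt_succ_of_le ((Finset.card_le_univ _).trans (by simp))
  simp [capTop, h]

/-- The scaled probability vector `q^S` computed from the weights `w`: normalise on `S`, cap at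
`1 / k` if some entry is at least `1 / k`, and multiply by `k`. If fewer than `k` arms are
available, this is the indicator of `S`. -/
def scaledProb {N : ℕ} (k : ℕ) (S : Finset (Fin N)) (w : Fin N → ℝ) (i : Fin N) : ℝ :=
  if i ∈ S then
    (k : ℝ) *
      (if ∃ j ∈ S, 1 / (k : ℝ) ≤ normalized S w j then
        capTop k (normalized S w) (capStop k (normalized S w)) i
      else normalized S w i)
  else 0

/-! ### Mixture decomposition -/

/-- The cap that the entries of the remaining vector `p` obey during the decomposition. It is `1`
for a vector of total mass `k`, and drops by `q` whenever `q` times a corner is subtracted. -/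
def capLevel {N : ℕ} (k : ℕ) (p : Fin N → ℝ) : ℝ := (∑ i, p i) / k

/-- `MixtureRun k p D`: some complete run of the mixture decomposition started at `p` outputs
`D`, where `D r` is the total coefficient given to the corner (the indicator vector) of the set
`r`. In each pass, `r` is any set of `k` nonzero components that contains all components at the
cap, `s` is the smallest entry of `p` on `r`, and `l` is the largest entry of `p` outside `r`
(`0` if there is none). -/
inductive MixtureRun {N : ℕ} (k : ℕ) : (Fin N → ℝ) → (Finset (Fin N) → ℝ) → Prop
  | done (p : Fin N → ℝ) (hp : ¬ ∃ i, 0 < p i) : MixtureRun k p 0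
  | pass (p : Fin N → ℝ) (D : Finset (Fin N) → ℝ) (r : Finset (Fin N)) (s l : ℝ)
      (hp : ∃ i, 0 < p i)
      (hcard : r.card = k)
      (hsupp : ∀ i ∈ r, p i ≠ 0)
      (hcap : ∀ i, p i = capLevel k p → i ∈ r)
      (hs : IsLeast {x | ∃ i ∈ r, p i = x} s)
      (hl : IsGreatest (insert 0 {x | ∃ i, i ∉ r ∧ p i = x}) l)
      (hD : MixtureRun k
        (fun i => p i - if i ∈ r then min s (capLevel k p - l) else 0) D) :
      MixtureRun k p
        (fun A => (if A = r then min s (capLevel k p - l) else 0) + D A)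

/-- An implementation of the mixture decomposition: it maps every vector `p` with entries in
`[0,1]` and total mass `k` to the output of a complete run from `p`. -/
structure MixtureRule (N k : ℕ) where
  /-- The coefficients produced from the input vector. -/
  coeff : (Fin N → ℝ) → Finset (Fin N) → ℝ
  isRun : ∀ p : Fin N → ℝ, (∀ i, 0 ≤ p i ∧ p i ≤ 1) → ∑ i, p i = k → MixtureRun k p (coeff p)

/-- Every nonnegative vector whose entries are at most the cap has a complete run. -/
theorem exists_mixtureRun {N k : ℕ} (hk : 1 ≤ k) (p : Fin N → ℝ)
    (hp0 : ∀ i, 0 ≤ p i) (hp1 : ∀ i, p i ≤ capLevel k p) : ∃ D, MixtureRun k p D := by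
  have hk0 : (0 : ℝ) < k := by exact_mod_cast hk
  induction hn : (Finset.univ.filter fun i => p i ≠ 0 ∧ p i ≠ capLevel k p).card
    using Nat.strong_induction_on generalizing p with
  | _ n ih =>
  by_cases hpos : ∃ i, 0 < p i
  swap
  · exact ⟨_, .done p hpos⟩
  have hsum : ∑ i, p i = k * capLevel k p := by rw [capLevel]; field_simp
  have hc : 0 < capLevel k p := by
    obtain ⟨i, hi⟩ := hpos
    exact hi.trans_le (hp1 i)
  -- a corner exists
  have hA : (Finset.univ.filter fun i => p i = capLevel k p).card ≤ k := by
    have h1 : ∑ i ∈ Finset.univ.filter (fun i => p i = capLevel k p), p i ≤ ∑ i, p i :=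
      Finset.sum_le_sum_of_subset_of_nonneg (Finset.filter_subset _ _) fun i _ _ => hp0 i
    rw [Finset.sum_congr rfl (g := fun _ => capLevel k p) (by simp), Finset.sum_const,
      nsmul_eq_mul, hsum] at h1
    exact_mod_cast le_of_mul_le_mul_right h1 hc
  have hB : k ≤ (Finset.univ.filter fun i => p i ≠ 0).card := by
    have h1 : ∑ i, p i = ∑ i ∈ Finset.univ.filter (fun i => p i ≠ 0), p i :=
      (Finset.sum_filter_ne_zero _).symm
    have h2 : ∑ i ∈ Finset.univ.filter (fun i => p i ≠ 0), p i
        ≤ ∑ i ∈ Finset.univ.filter (fun i => p i ≠ 0), capLevel k p :=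
      Finset.sum_le_sum fun i _ => hp1 i
    rw [← h1, hsum, Finset.sum_const, nsmul_eq_mul] at h2
    exact_mod_cast le_of_mul_le_mul_right h2 hc
  obtain ⟨r, hAr, hrB, hcard⟩ := Finset.exists_subsuperset_card_eq
    (s := Finset.univ.filter fun i => p i = capLevel k p)
    (t := Finset.univ.filter fun i => p i ≠ 0)
    (fun i hi => by
      simp only [Finset.mem_filter, Finset.mem_univ, true_and] at hi ⊢
      rw [hi]; exact hc.ne') hA hB
  have hsupp : ∀ i ∈ r, p i ≠ 0 := fun i hi => by simpa using hrB hi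
  have hcap : ∀ i, p i = capLevel k p → i ∈ r := fun i hi => hAr (by simpa using hi)
  have hrne : r.Nonempty := Finset.card_pos.mp (by omega)
  obtain ⟨i₀, hi₀, hmin⟩ := r.exists_min_image p hrne
  have hs : IsLeast {x | ∃ i ∈ r, p i = x} (p i₀) :=
    ⟨⟨i₀, hi₀, rfl⟩, by rintro x ⟨i, hi, rfl⟩; exact hmin i hi⟩
  obtain ⟨l, hl⟩ : ∃ l, IsGreatest (insert 0 {x | ∃ i, i ∉ r ∧ p i = x}) l := by
    have hf : (insert (0 : ℝ) {x | ∃ i, i ∉ r ∧ p i = x}).Finite :=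
      (Set.Finite.subset (Set.finite_range p) (by rintro x ⟨i, _, rfl⟩; exact ⟨i, rfl⟩)).insert 0
    obtain ⟨l, h1, h2⟩ := Set.exists_max_image _ id hf ⟨0, Set.mem_insert _ _⟩
    exact ⟨l, h1, fun x hx => h2 x hx⟩
  have hl0 : 0 ≤ l := hl.2 (Set.mem_insert _ _)
  have hlj : ∀ j, j ∉ r → p j ≤ l := fun j hj => hl.2 (Or.inr ⟨j, hj, rfl⟩)
  set c := capLevel k p with hcdef
  set q := min (p i₀) (c - l) with hq
  set p' : Fin N → ℝ := fun i => p i - if i ∈ r then q else 0 with hp'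
  have hqs : q ≤ p i₀ := min_le_left _ _
  have hql : q ≤ c - l := min_le_right _ _
  have hc' : capLevel k p' = c - q := by
    have : ∑ i, p' i = k * c - k * q := by
      simp only [hp', Finset.sum_sub_distrib, hsum, Finset.sum_ite_mem, Finset.univ_inter,
        Finset.sum_const, hcard, nsmul_eq_mul]
    rw [capLevel, this]; field_simp
  have hin : ∀ i ∈ r, p' i = p i - q := fun i hi => by simp [hp', hi]
  have hout : ∀ i, i ∉ r → p' i = p i := fun i hi => by simp [hp', hi]
  have h0' : ∀ i, 0 ≤ p' i := fun i => by
    by_cases hi : i ∈ r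
    · rw [hin i hi]; linarith [hmin i hi]
    · rw [hout i hi]; exact hp0 i
  have h1' : ∀ i, p' i ≤ capLevel k p' := fun i => by
    rw [hc']
    by_cases hi : i ∈ r
    · rw [hin i hi]; linarith [hp1 i]
    · rw [hout i hi]; linarith [hlj i hi]
  have fin : (∃ D, MixtureRun k p' D) → ∃ D, MixtureRun k p D := fun ⟨D, hD⟩ =>
    ⟨_, .pass p D r (p i₀) l hpos hcard hsupp hcap hs hl hD⟩
  apply fin
  by_cases hz : ∃ i, 0 < p' i
  swap
  · exact ⟨_, .done p' hz⟩
  refine ih _ ?_ p' h0' h1' rfl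
  rw [← hn]
  -- the set of components strictly between `0` and the cap gets smaller
  have hsub : ∀ i, p' i ≠ 0 ∧ p' i ≠ capLevel k p' → p i ≠ 0 ∧ p i ≠ c := by
    rintro i ⟨ha, hb⟩
    constructor
    · intro h
      have hi : i ∉ r := fun hi => hsupp i hi h
      exact ha (by rw [hout i hi, h])
    · intro h
      exact hb (by rw [hin i (hcap i h), hc', h])
  apply Finset.card_lt_card
  rw [Finset.ssubset_iff_of_subset fun i hi => by simpa using hsub i (by simpa using hi)]
  have hcase : ∀ h : q = p i₀, ∃ x ∈ Finset.univ.filter (fun i => p i ≠ 0 ∧ p i ≠ c),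
      x ∉ Finset.univ.filter (fun i => p' i ≠ 0 ∧ p' i ≠ capLevel k p') := by
    intro h
    refine ⟨i₀, ?_, ?_⟩
    · simp only [Finset.mem_filter, Finset.mem_univ, true_and]
      refine ⟨hsupp _ hi₀, fun h2 => ?_⟩
      obtain ⟨i, hi⟩ := hz
      have := h1' i
      rw [hc'] at this
      linarith
    · simp [hin _ hi₀, h]
  rcases min_choice (p i₀) (c - l) with h | h
  · exact hcase h
  · rcases hl.1 with h2 | ⟨j, hj, h2⟩
    · refine hcase (le_antisymm hqs ?_)
      rw [hq, h, h2]
      linarith [hp1 i₀]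
    · by_cases hl00 : l = 0
      · refine hcase (le_antisymm hqs ?_)
        rw [hq, h, hl00]
        linarith [hp1 i₀]
      · refine ⟨j, ?_, ?_⟩
        · simp only [Finset.mem_filter, Finset.mem_univ, true_and]
          exact ⟨by rw [h2]; exact hl00, fun h3 => hj (hcap j h3)⟩
        · simp only [Finset.mem_filter, Finset.mem_univ, true_and, not_and, not_not]
          intro _
          rw [hout j hj, hc', hq, h, h2]; ring

/-- Implementations of the mixture decomposition exist. -/
theorem nonempty_mixtureRule (N : ℕ) {k : ℕ} (hk : 1 ≤ k) : Nonempty (MixtureRule N k) := by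
  have hk0 : (k : ℝ) ≠ 0 := by exact_mod_cast (by omega : k ≠ 0)
  have H : ∀ p : Fin N → ℝ, ∃ D, (∀ i, 0 ≤ p i ∧ p i ≤ 1) → ∑ i, p i = k →
      MixtureRun k p D := by
    intro p
    by_cases h : (∀ i, 0 ≤ p i ∧ p i ≤ 1) ∧ ∑ i, p i = k
    · obtain ⟨D, hD⟩ := exists_mixtureRun hk p (fun i => (h.1 i).1) fun i => by
        rw [capLevel, h.2, div_self hk0]; exact (h.1 i).2
      exact ⟨D, fun _ _ => hD⟩
    · exact ⟨0, fun h1 h2 => absurd ⟨h1, h2⟩ h⟩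
  choose f hf using H
  exact ⟨⟨f, hf⟩⟩

/-! ### The learning algorithm -/

/-- One round: the set of available arms and the set of played arms. -/
abbrev Round (N : ℕ) := Finset (Fin N) × Finset (Fin N)

/-- The rounds played so far, the most recent one first. -/
abbrev History (N : ℕ) := List (Round N)

/-- Probability of the available set `S` when arm `i` is available with probability `a i`,
independently of the other arms. -/
def availProb {N : ℕ} (a : Fin N → ℝ) (S : Finset (Fin N)) : ℝ :=
  ∏ i, if i ∈ S then a i else 1 - a i

/-- Empirical availability frequencies. -/
def empAvail {N : ℕ} (h : History N) (i : Fin N) : ℝ :=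
  (h.countP fun r => i ∈ r.1 : ℝ) / h.length

/-- Plug-in estimate of the probability that an arm is available and selected, for the current
weights `w` and the history `h` (which includes the current round). -/
def jointEst {N : ℕ} (k : ℕ) (w : Fin N → ℝ) (h : History N) (i : Fin N) : ℝ :=
  ∑ S : Finset (Fin N), availProb (empAvail h) S * scaledProb k S w i

/-- Estimated loss in the round `r` that follows the history `h`, with current weights `w`. -/
def estLoss {N : ℕ} (k : ℕ) (lam : ℕ → ℝ) (loss : ℕ → Fin N → ℝ) (w : Fin N → ℝ)
    (r : Round N) (h : History N) (i : Fin N) : ℝ :=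
  if i ∈ r.2 then loss (h.length + 1) i / (jointEst k w (r :: h) i + lam (h.length + 1)) else 0

/-- The weights of the algorithm after the history `h`. -/
def weights {N : ℕ} (k : ℕ) (lam : ℕ → ℝ) (eta : ℝ) (loss : ℕ → Fin N → ℝ) :
    History N → Fin N → ℝ
  | [] => fun _ => 1
  | r :: h => fun i =>
      weights k lam eta loss h i *
        Real.exp (-eta * estLoss k lam loss (weights k lam eta loss h) r h i)

/-- Probability of playing the set `A` when `S` is available and the weights are `w`. If fewer
than `k` arms are available, all of them are played. -/
def playProb {N k : ℕ} (mix : MixtureRule N k) (w : Fin N → ℝ) (S A : Finset (Fin N)) : ℝ :=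
  if S.card < k then (if A = S then 1 else 0) else mix.coeff (scaledProb k S w) A

/-- Probability of the history `h` when the algorithm is run. -/
def historyProb {N k : ℕ} (mix : MixtureRule N k) (lam : ℕ → ℝ) (eta : ℝ) (a : Fin N → ℝ)
    (loss : ℕ → Fin N → ℝ) : History N → ℝ
  | [] => 1
  | r :: h =>
      historyProb mix lam eta a loss h *
        (availProb a r.1 * playProb mix (weights k lam eta loss h) r.1 r.2)

/-- Expectation of a function of the first `T` rounds. -/
def expectation {N k : ℕ} (mix : MixtureRule N k) (lam : ℕ → ℝ) (eta : ℝ) (a : Fin N → ℝ)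
    (loss : ℕ → Fin N → ℝ) (T : ℕ) (f : History N → ℝ) : ℝ :=
  ∑ h : List.Vector (Round N) T, historyProb mix lam eta a loss h.toList * f h.toList

/-! ### Regret -/

/-- Policies: they map each available set to `k` of its arms, and to all of its arms if there
are fewer than `k`. -/
def Policy (N k : ℕ) : Type :=
  {π : Finset (Fin N) → Finset (Fin N) // ∀ S, π S ⊆ S ∧ (π S).card = min k S.card}

/-- Cumulative loss of the played arms minus that of the policy `π` along the history. -/
def excessLoss {N : ℕ} (loss : ℕ → Fin N → ℝ) (π : Finset (Fin N) → Finset (Fin N)) :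
    History N → ℝ
  | [] => 0
  | r :: h =>
      excessLoss loss π h +
        (∑ i ∈ r.2, loss (h.length + 1) i - ∑ i ∈ π r.1, loss (h.length + 1) i)

/-- The expected regret against the best policy (a maximum over the finite nonempty set of
policies). -/
def regret {N k : ℕ} (mix : MixtureRule N k) (lam : ℕ → ℝ) (eta : ℝ) (a : Fin N → ℝ)
    (loss : ℕ → Fin N → ℝ) (T : ℕ) : ℝ :=
  ⨆ π : Policy N k, expectation mix lam eta a loss T (excessLoss loss π.1)

end

end SleepingBandit

namespace SleepingBandit

/-! ### Random availabilities -/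

/-! Fix a policy. Since the next available set is independent of the history, the conditional
expected excess loss of a round is `∑ i, (q i - u i) * ℓ i`, where `q` averages the scaled
probabilities over all available sets and `u` is the probability that the policy plays `i`
(`stepExp_excess`).

For every set `S`, drawn or not, the scaled probabilities have the form `min 1 (c * w i)`
(`scaledProb_dichotomy`, `exists_scaledProb_eq_min`) when `S` has at least `k` arms. They therefore
minimise entropy plus cumulative estimated loss over the capped simplex on `S`. One virtual
regularised leader thus runs for each `S`, all fed with the same loss estimates. Each has pathwise
regret at most `k log (N/k) / η`, up to a second-order term (`pathSum_regret_le`). Averaging over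
the true law of `S` turns these bounds into one for `q` and `u` (`pathSum_estRegretIncr_le`).

It remains to replace estimated losses by true ones. The denominator of the estimate uses empirical
availabilities. Its error is at most the total variation distance of two product laws, hence at most
the `ℓ¹` error of the frequencies (`abs_sum_availProb_sub_le`). Unless that error, truncated at `1`,
exceeds `lam`, the shifted denominator lies in `[q, q + 2 lam]`: the bias is then `O(lam)` and the
second-order term `O(η)` per arm. A Chernoff bound makes the exceptional event so rare that even
estimates of size `1 / lam` cost little (`estimate_bias_variance`, `expectation_badInd_le`). Summing
`lam ≲ k N √(log T / t)` over arms and rounds gives the dominant term. -/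

theorem sum_prod_ite_mem {N : ℕ} (b c : Fin N → ℝ) :
    ∑ S : Finset (Fin N), ∏ i, (if i ∈ S then b i else c i) = ∏ i, (b i + c i) := by
  rw [Finset.prod_add, Finset.powerset_univ]
  refine Finset.sum_congr rfl fun S _ => ?_
  rw [Finset.prod_ite]
  congr 1
  · congr 1; ext; simp
  · congr 1; ext; simp

theorem sum_availProb {N : ℕ} (a : Fin N → ℝ) : ∑ S, availProb a S = 1 := by
  simp [availProb, sum_prod_ite_mem]

theorem availProb_nonneg {N : ℕ} {a : Fin N → ℝ} (ha : ∀ i, 0 ≤ a i ∧ a i ≤ 1)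
    (S : Finset (Fin N)) : 0 ≤ availProb a S := by
  refine Finset.prod_nonneg fun i _ => ?_
  split_ifs
  · exact (ha i).1
  · linarith [(ha i).2]

/-- The law of the availability of a single arm. -/
theorem sum_availProb_mul_ite {N : ℕ} (a : Fin N → ℝ) (i : Fin N) (x y : ℝ) :
    ∑ S, availProb a S * (if i ∈ S then x else y) = a i * x + (1 - a i) * y := by
  have h : ∀ S : Finset (Fin N), availProb a S * (if i ∈ S then x else y) =
      ∏ j, (if j ∈ S then a j * (if j = i then x else 1)
        else (1 - a j) * (if j = i then y else 1)) := by
    intro S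
    rw [availProb, ← Fintype.prod_ite_eq' i (fun j => if j ∈ S then x else y),
      ← Finset.prod_mul_distrib]
    refine Finset.prod_congr rfl fun j _ => ?_
    rcases eq_or_ne j i with rfl | h2
    · by_cases h1 : j ∈ S <;> simp [h1]
    · by_cases h1 : j ∈ S <;> simp [h1, h2]
  simp_rw [h]
  rw [sum_prod_ite_mem, Fintype.prod_eq_single i]
  · simp
  · intro j hj
    simp [hj]

/-- Only the factor of arm `i` involves `x`, and that factor is affine in `x`. -/
theorem availProb_update {N : ℕ} (a : Fin N → ℝ) (i : Fin N) (x : ℝ) (S : Finset (Fin N)) :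
    availProb (Function.update a i x) S =
      x * availProb (Function.update a i 1) S + (1 - x) * availProb (Function.update a i 0) S := by
  have h : ∀ y, availProb (Function.update a i y) S =
      (if i ∈ S then y else 1 - y) * ∏ j ∈ Finset.univ.erase i, if j ∈ S then a j else 1 - a j := by
    intro y
    rw [availProb, ← Finset.mul_prod_erase _ _ (Finset.mem_univ i)]
    congr 1
    · simp
    · refine Finset.prod_congr rfl fun j hj => ?_
      rw [Function.update_of_ne (Finset.ne_of_mem_erase hj)]
  rw [h x, h 1, h 0]
  by_cases hi : i ∈ S <;> simp [hi]

theorem sum_availProb_mul_mem_Icc {N : ℕ} {a : Fin N → ℝ} (ha : ∀ i, 0 ≤ a i ∧ a i ≤ 1)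
    {f : Finset (Fin N) → ℝ} (hf : ∀ S, 0 ≤ f S ∧ f S ≤ 1) :
    0 ≤ ∑ S, availProb a S * f S ∧ ∑ S, availProb a S * f S ≤ 1 := by
  refine ⟨Finset.sum_nonneg fun S _ => mul_nonneg (availProb_nonneg ha S) (hf S).1, ?_⟩
  calc _ ≤ ∑ S, availProb a S := Finset.sum_le_sum fun S _ =>
        mul_le_of_le_one_right (availProb_nonneg ha S) (hf S).2
    _ = 1 := sum_availProb a

/-- By affinity the difference is `(x - y) * (F - G)`, where `F` and `G` are means of `f` with arm
`i` surely present and surely absent; both lie in `[0,1]`. -/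
theorem abs_sum_availProb_update_sub_le {N : ℕ} {a : Fin N → ℝ} (ha : ∀ i, 0 ≤ a i ∧ a i ≤ 1)
    {f : Finset (Fin N) → ℝ} (hf : ∀ S, 0 ≤ f S ∧ f S ≤ 1) (i : Fin N) (x y : ℝ) :
    |∑ S, availProb (Function.update a i x) S * f S -
      ∑ S, availProb (Function.update a i y) S * f S| ≤ |x - y| := by
  have h01 : ∀ z : ℝ, 0 ≤ z ∧ z ≤ 1 → ∀ j, 0 ≤ Function.update a i z j ∧
      Function.update a i z j ≤ 1 := by
    intro z hz j
    by_cases h : j = i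
    · subst h; simpa using hz
    · simpa [h] using ha j
  have h1 := sum_availProb_mul_mem_Icc (h01 1 (by norm_num)) hf
  have h0 := sum_availProb_mul_mem_Icc (h01 0 (by norm_num)) hf
  have key : ∀ z, ∑ S, availProb (Function.update a i z) S * f S =
      z * ∑ S, availProb (Function.update a i 1) S * f S +
        (1 - z) * ∑ S, availProb (Function.update a i 0) S * f S := by
    intro z
    rw [Finset.mul_sum, Finset.mul_sum, ← Finset.sum_add_distrib]
    refine Finset.sum_congr rfl fun S _ => ?_
    rw [availProb_update a i z S]; ring
  rw [key x, key y]
  set F := ∑ S, availProb (Function.update a i 1) S * f S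
  set G := ∑ S, availProb (Function.update a i 0) S * f S
  rw [show x * F + (1 - x) * G - (y * F + (1 - y) * G) = (x - y) * (F - G) by ring, abs_mul]
  refine mul_le_of_le_one_right (abs_nonneg _) ?_
  rw [abs_le]; constructor <;> linarith [h1.1, h1.2, h0.1, h0.2]

/-- The total variation distance of two availability laws is at most the `ℓ¹` distance of their
parameters. -/
theorem abs_sum_availProb_sub_le {N : ℕ} {a b : Fin N → ℝ} (ha : ∀ i, 0 ≤ a i ∧ a i ≤ 1)
    (hb : ∀ i, 0 ≤ b i ∧ b i ≤ 1) {f : Finset (Fin N) → ℝ} (hf : ∀ S, 0 ≤ f S ∧ f S ≤ 1) :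
    |∑ S, availProb a S * f S - ∑ S, availProb b S * f S| ≤ min 1 (∑ i, |a i - b i|) := by
  refine le_min ?_ ?_
  · have h1 := sum_availProb_mul_mem_Icc ha hf
    have h2 := sum_availProb_mul_mem_Icc hb hf
    rw [abs_le]; constructor <;> linarith [h1.1, h1.2, h2.1, h2.2]
  -- Hybrid argument: pass from `b` to `a` one coordinate at a time, through the vectors
  -- `s.piecewise a b`.
  have key : ∀ s : Finset (Fin N),
      |∑ S, availProb (s.piecewise a b) S * f S - ∑ S, availProb b S * f S| ≤
        ∑ i ∈ s, |a i - b i| := by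
    intro s
    induction s using Finset.induction_on with
    | empty => simp
    | insert i s hi ih =>
      rw [Finset.sum_insert hi, Finset.piecewise_insert]
      have h01 : ∀ j, 0 ≤ s.piecewise a b j ∧ s.piecewise a b j ≤ 1 := by
        intro j
        by_cases h : j ∈ s
        · simpa [h] using ha j
        · simpa [h] using hb j
      have h := abs_sum_availProb_update_sub_le h01 hf i (a i) (b i)
      have h2 : Function.update (s.piecewise a b) i (b i) = s.piecewise a b := by
        rw [Function.update_eq_self_iff]; simp [hi]
      rw [h2] at h
      exact (abs_sub_le _ _ _).trans (add_le_add h ih)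
  simpa using key Finset.univ

/-! ### Capped probabilities -/

theorem position_lt {N : ℕ} (p : Fin N → ℝ) (j : Fin N) : position p j < N := by
  have : (Finset.univ.filter fun m => p j < p m ∨ (p m = p j ∧ m < j)) ⊂ Finset.univ := by
    rw [Finset.ssubset_univ_iff]
    intro h
    have := Finset.mem_univ j
    rw [← h] at this
    simp at this
  simpa [position] using Finset.card_lt_card this

theorem position_lt_position {N : ℕ} {p : Fin N → ℝ} {i j : Fin N}
    (h : p j < p i ∨ (p i = p j ∧ i < j)) : position p i < position p j := by
  refine Finset.card_lt_card ?_
  rw [Finset.ssubset_iff_of_subset]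
  · exact ⟨i, by simpa using h, by simp⟩
  · intro m hm
    simp only [Finset.mem_filter, Finset.mem_univ, true_and] at hm ⊢
    rcases h with h | ⟨h, h'⟩ <;> rcases hm with hm | ⟨hm, hm'⟩
    · left; linarith
    · left; linarith
    · left; linarith
    · right; exact ⟨hm.trans h, hm'.trans h'⟩

theorem position_injective {N : ℕ} (p : Fin N → ℝ) : Function.Injective (position p) := by
  intro i j hij
  by_contra hne
  have : (p j < p i ∨ (p i = p j ∧ i < j)) ∨ (p i < p j ∨ (p j = p i ∧ j < i)) := by
    rcases lt_trichotomy (p i) (p j) with h | h | h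
    · exact Or.inr (Or.inl h)
    · rcases lt_or_gt_of_ne hne with h' | h'
      · exact Or.inl (Or.inr ⟨h, h'⟩)
      · exact Or.inr (Or.inr ⟨h.symm, h'⟩)
    · exact Or.inl (Or.inl h)
  rcases this with h | h
  · exact absurd hij (position_lt_position h).ne
  · exact absurd hij (position_lt_position h).ne'

theorem le_of_position_le {N : ℕ} {p : Fin N → ℝ} {i j : Fin N}
    (h : position p i ≤ position p j) : p j ≤ p i := by
  by_contra! hlt
  exact absurd (position_lt_position (p := p) (Or.inl hlt)) (not_lt.mpr h)

theorem image_position {N : ℕ} (p : Fin N → ℝ) :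
    Finset.univ.image (position p) = Finset.range N := by
  apply Finset.eq_of_subset_of_card_le
  · intro x hx
    obtain ⟨j, -, rfl⟩ := Finset.mem_image.mp hx
    exact Finset.mem_range.mpr (position_lt p j)
  · rw [Finset.card_image_of_injective _ (position_injective p)]; simp

theorem exists_position_eq {N : ℕ} (p : Fin N → ℝ) {m : ℕ} (hm : m < N) :
    ∃ j, position p j = m := by
  have : m ∈ Finset.univ.image (position p) := by
    rw [image_position]; exact Finset.mem_range.mpr hm
  simpa using this

theorem card_position_lt {N : ℕ} (p : Fin N → ℝ) {m : ℕ} (hm : m ≤ N) :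
    (Finset.univ.filter fun j => position p j < m).card = m := by
  rw [← Finset.card_image_of_injective _ (position_injective p)]
  have : (Finset.univ.filter fun j => position p j < m).image (position p) = Finset.range m := by
    ext x
    simp only [Finset.mem_image, Finset.mem_filter, Finset.mem_univ, true_and, Finset.mem_range]
    constructor
    · rintro ⟨j, hj, rfl⟩; exact hj
    · intro hx
      obtain ⟨j, hj⟩ := exists_position_eq p (hx.trans_le hm)
      exact ⟨j, hj ▸ hx, hj⟩
  rw [this, Finset.card_range]

/-- If the capping loop is entered, it either leaves `1 / k` on the whole support, or it scales
the vector by a constant, truncates at `1 / k` and returns a probability vector. -/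
theorem capTop_capStop {N k : ℕ} (hk : 1 ≤ k) {p : Fin N → ℝ} (hp : ∀ i, 0 ≤ p i)
    (hsum : ∑ i, p i = 1) (hcap : ∃ j, 1 / (k : ℝ) ≤ p j) :
    ((Finset.univ.filter fun i => 0 < p i).card ≤ k ∧
      ∀ i, 0 < p i → capTop k p (capStop k p) i = 1 / k) ∨
    ((∃ c, 0 < c ∧ ∀ i, capTop k p (capStop k p) i = min (1 / (k : ℝ)) (c * p i)) ∧
      ∑ i, capTop k p (capStop k p) i = 1) := by
  have hk0 : (0 : ℝ) < k := by exact_mod_cast hk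
  obtain ⟨hm1, hmle⟩ := capStop_spec k p
  have hmin : ∀ i, 1 ≤ i → i < capStop k p → ∃ j, 1 / (k : ℝ) < capTop k p i j := by
    intro i hi1 hi
    by_contra! h
    exact absurd (Nat.sInf_le (show i ∈ {i : ℕ | 1 ≤ i ∧ ∀ j, capTop k p i j ≤ 1 / (k : ℝ)} from
      ⟨hi1, h⟩)) (not_le.mpr hi)
  set m := capStop k p
  obtain ⟨n, hn⟩ : ∃ n, m = n + 1 := ⟨m - 1, by omega⟩
  set R : ℕ → ℝ := fun i => ∑ l with i ≤ position p l, p l with hR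
  have hR0 : ∀ i, 0 ≤ R i := fun i => Finset.sum_nonneg fun j _ => hp j
  have hRzero : R 0 = 1 := by simp [hR, hsum]
  -- in the pass before the last one, some remaining entry is at least the cap
  obtain ⟨j, hjn, hj⟩ : ∃ j, n ≤ position p j ∧ 1 / (k : ℝ) ≤ ((k : ℝ) - n) / k * (p j / R n) := by
    rcases Nat.eq_zero_or_pos n with h | h
    · obtain ⟨j, hj⟩ := hcap
      refine ⟨j, by omega, ?_⟩
      rw [h, hRzero]
      simpa [hk0.ne'] using hj
    · obtain ⟨j, hj⟩ := hmin n h (by omega)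
      rw [capTop] at hj
      split_ifs at hj with h1
      · exact absurd hj (lt_irrefl _)
      · exact ⟨j, not_lt.mp h1, hj.le⟩
  have hnN : n < N := hjn.trans_lt (position_lt p j)
  obtain ⟨x, hx⟩ := exists_position_eq p hnN
  have hinv : 0 < 1 / (k : ℝ) := by positivity
  have hRn : 0 < R n := by
    rcases (hR0 n).lt_or_eq with h | h
    · exact h
    · rw [← h] at hj; simp at hj; linarith
  have hkn : (0 : ℝ) < (k : ℝ) - n := by
    by_contra! h
    have h1 : ((k : ℝ) - n) / k * (p j / R n) ≤ 0 :=
      mul_nonpos_of_nonpos_of_nonneg (div_nonpos_of_nonpos_of_nonneg h hk0.le)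
        (div_nonneg (hp j) hRn.le)
    linarith
  have hmk : m ≤ k := by
    have : n < k := by exact_mod_cast (by linarith : (n : ℝ) < k)
    omega
  have hjx : p j ≤ p x := le_of_position_le (by omega)
  have hcx : 1 / (k : ℝ) ≤ ((k : ℝ) - n) / k * (p x / R n) := hj.trans (by gcongr)
  have hpx : 0 < p x := by
    rcases (hp x).lt_or_eq with h | h
    · exact h
    · rw [← h] at hcx; simp at hcx; linarith
  have htop : ∀ i, position p i < m → p x ≤ p i := fun i hi => le_of_position_le (by omega)
  have hRsplit : R n = p x + R m := by
    have : (Finset.univ.filter fun l => n ≤ position p l) =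
        insert x (Finset.univ.filter fun l => m ≤ position p l) := by
      ext l
      simp only [Finset.mem_filter, Finset.mem_univ, true_and, Finset.mem_insert]
      constructor
      · intro h
        rcases h.eq_or_lt with h | h
        · exact Or.inl (position_injective p (by omega))
        · exact Or.inr (by omega)
      · rintro (rfl | h) <;> omega
    simp only [hR]
    rw [this, Finset.sum_insert]
    simp; omega
  -- If nothing remains beyond the `m` largest entries, the whole support is capped; only then, by
  -- `0 / 0 = 0`, can the result have mass below `1`.
  rcases (hR0 m).lt_or_eq with hRm | hRm
  · right
    -- The scaling factor `(k - i) / R i` does not decrease in the last pass, because the entry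
    -- removed holds at least the fraction `1 / (k - n)` of the mass `R n`. Hence all entries set to
    -- the cap would also reach it under the final scaling, and capping is truncation.
    have hRmle : ((k : ℝ) - n) * R m ≤ ((k : ℝ) - m) * R n := by
      have h1 : R n ≤ ((k : ℝ) - n) * p x := by
        have : 1 / (k : ℝ) * (k * R n) ≤ ((k : ℝ) - n) / k * (p x / R n) * (k * R n) := by gcongr
        rw [show ((k : ℝ) - n) / k * (p x / R n) * (k * R n) = ((k : ℝ) - n) * p x by field_simp,
          show 1 / (k : ℝ) * (k * R n) = R n by field_simp] at this
        exact this
      have h2 : (m : ℝ) = n + 1 := by rw [hn]; push_cast; ring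
      rw [h2]
      nlinarith
    have hkm : 0 < (k : ℝ) - m := by
      have : 0 < ((k : ℝ) - m) * R n := lt_of_lt_of_le (by positivity) hRmle
      exact pos_of_mul_pos_left this hRn.le
    refine ⟨⟨((k : ℝ) - m) / k / R m, by positivity, fun i => ?_⟩, ?_⟩
    · have hi := hmle i
      by_cases h : position p i < m
      · rw [capTop, if_pos h, min_eq_left]
        calc 1 / (k : ℝ) ≤ ((k : ℝ) - n) / k * (p x / R n) := hcx
          _ ≤ ((k : ℝ) - n) / k * (p i / R n) := by gcongr; exact htop i h
          _ = (((k : ℝ) - n) / R n) * (p i / k) := by ring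
          _ ≤ (((k : ℝ) - m) / R m) * (p i / k) := by
              have := hp i
              gcongr ?_ * _
              rw [div_le_div_iff₀ hRn hRm]; exact hRmle
          _ = _ := by ring
      · rw [capTop, if_neg h] at hi ⊢
        rw [min_eq_right]
        · ring
        · calc _ = ((k : ℝ) - m) / k * (p i / R m) := by ring
            _ ≤ _ := hi
    · have : ∀ i, capTop k p m i = (if position p i < m then 1 / (k : ℝ) else 0) +
          (if m ≤ position p i then ((k : ℝ) - m) / k / R m * p i else 0) := by
        intro i
        by_cases h : position p i < m
        · simp [capTop, h]
        · rw [capTop, if_neg h, if_neg h, if_pos (not_lt.mp h)]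
          simp only [hR]; ring
      simp_rw [this]
      rw [Finset.sum_add_distrib, ← Finset.sum_filter, ← Finset.sum_filter, Finset.sum_const,
        card_position_lt p (by omega), ← Finset.mul_sum]
      change m • (1 / (k : ℝ)) + ((k : ℝ) - m) / k / R m * R m = 1
      rw [nsmul_eq_mul]
      field_simp; ring
  · left
    have hzero : ∀ i, m ≤ position p i → p i = 0 := by
      have := (Finset.sum_eq_zero_iff_of_nonneg (fun j _ => hp j)).mp hRm.symm
      intro i hi
      exact this i (by simpa using hi)
    have hiff : ∀ i, 0 < p i → position p i < m := by
      intro i hi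
      by_contra! h
      exact hi.ne' (hzero i h)
    refine ⟨?_, fun i hi => by rw [capTop, if_pos (hiff i hi)]⟩
    refine le_trans ?_ hmk
    rw [← card_position_lt p (show m ≤ N by omega)]
    exact Finset.card_le_card fun i hi => by
      simp only [Finset.mem_filter, Finset.mem_univ, true_and] at hi ⊢; exact hiff i hi

theorem scaledProb_of_notMem {N k : ℕ} {S : Finset (Fin N)} {w : Fin N → ℝ} {i : Fin N}
    (hi : i ∉ S) : scaledProb k S w i = 0 := by simp [scaledProb, hi]

/-- The outcome of the capping loop in terms of the weights: normalising and multiplying by `k` only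
change the constant `c`. If the loop is not entered, the truncation is inactive. The first
alternative accounts for sets too small to carry mass `k`. -/
theorem scaledProb_dichotomy {N k : ℕ} (hk : 1 ≤ k) (S : Finset (Fin N)) {w : Fin N → ℝ}
    (hw : ∀ i, 0 < w i) :
    (S.card ≤ k ∧ ∀ i ∈ S, scaledProb k S w i = 1) ∨
    ((∃ c, 0 < c ∧ ∀ i ∈ S, scaledProb k S w i = min 1 (c * w i)) ∧
      ∑ i, scaledProb k S w i = k) := by
  have hk0 : (0 : ℝ) < k := by exact_mod_cast hk
  rcases S.eq_empty_or_nonempty with rfl | hS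
  · left; simp
  set W := ∑ j ∈ S, w j with hW
  have hWpos : 0 < W := Finset.sum_pos (fun j _ => hw j) hS
  have hin : ∀ i ∈ S, normalized S w i = w i / W := fun i hi => by simp [normalized, hi, hW]
  have hout : ∀ i, i ∉ S → normalized S w i = 0 := fun i hi => by simp [normalized, hi]
  have hp : ∀ i, 0 ≤ normalized S w i := by
    intro i
    by_cases hi : i ∈ S
    · rw [hin i hi]; exact div_nonneg (hw i).le hWpos.le
    · rw [hout i hi]
  have hpos : ∀ i, 0 < normalized S w i ↔ i ∈ S := by
    intro i
    constructor
    · intro h; by_contra hi; rw [hout i hi] at h; exact lt_irrefl _ h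
    · intro hi; rw [hin i hi]; exact div_pos (hw i) hWpos
  have hsum : ∑ i, normalized S w i = 1 := by
    rw [← Finset.sum_subset S.subset_univ fun i _ hi => hout i hi,
      Finset.sum_congr rfl hin, ← Finset.sum_div, div_self hWpos.ne']
  by_cases hcap : ∃ j ∈ S, 1 / (k : ℝ) ≤ normalized S w j
  · have hq : ∀ i ∈ S, scaledProb k S w i =
        k * capTop k (normalized S w) (capStop k (normalized S w)) i := fun i hi => by
      rw [scaledProb, if_pos hi, if_pos hcap]
    obtain ⟨j, -, hj⟩ := hcap
    rcases capTop_capStop hk hp hsum ⟨j, hj⟩ with ⟨h1, h2⟩ | ⟨⟨c, hc, h1⟩, h2⟩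
    · left
      refine ⟨?_, fun i hi => ?_⟩
      · convert h1; ext i; simp [hpos]
      · rw [hq i hi, h2 i ((hpos i).mpr hi)]; field_simp
    · right
      refine ⟨⟨k * (c / W), by positivity, fun i hi => ?_⟩, ?_⟩
      · rw [hq i hi, h1, hin i hi, mul_min_of_nonneg _ _ hk0.le]
        congr 1
        · field_simp
        · ring
      · rw [← mul_one (k : ℝ), ← h2, Finset.mul_sum]
        refine Finset.sum_congr rfl fun i _ => ?_
        by_cases hi : i ∈ S
        · exact hq i hi
        · rw [h1, hout i hi, scaledProb_of_notMem hi]; simp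
  · right
    have hq : ∀ i, scaledProb k S w i = k * normalized S w i := fun i => by
      by_cases hi : i ∈ S
      · rw [scaledProb, if_pos hi, if_neg hcap]
      · rw [scaledProb_of_notMem hi, hout i hi, mul_zero]
    push Not at hcap
    refine ⟨⟨k / W, by positivity, fun i hi => ?_⟩, ?_⟩
    · have h := hcap i hi
      rw [hq, hin i hi] at *
      rw [min_eq_right]
      · ring
      · rw [lt_div_iff₀ hk0] at h
        calc k / W * w i = w i / W * k := by ring
          _ ≤ 1 := h.le
    · simp_rw [hq]
      rw [← Finset.mul_sum, hsum, mul_one]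

theorem scaledProb_mem_Icc {N k : ℕ} (hk : 1 ≤ k) (S : Finset (Fin N)) {w : Fin N → ℝ}
    (hw : ∀ i, 0 < w i) (i : Fin N) : 0 ≤ scaledProb k S w i ∧ scaledProb k S w i ≤ 1 := by
  by_cases hi : i ∈ S
  · rcases scaledProb_dichotomy hk S hw with ⟨-, h⟩ | ⟨⟨c, hc, h⟩, -⟩
    · rw [h i hi]; norm_num
    · rw [h i hi]
      exact ⟨le_min zero_le_one (mul_nonneg hc.le (hw i).le), min_le_left _ _⟩
  · rw [scaledProb_of_notMem hi]; norm_num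

/-- In the second alternative of `scaledProb_dichotomy`, at most `k` entries, none above `1`, sum to
`k`; so each is `1`. -/
theorem scaledProb_of_card_le {N k : ℕ} (hk : 1 ≤ k) {S : Finset (Fin N)} (hS : S.card ≤ k)
    {w : Fin N → ℝ} (hw : ∀ i, 0 < w i) (i : Fin N) :
    scaledProb k S w i = if i ∈ S then 1 else 0 := by
  split_ifs with hi
  · rcases scaledProb_dichotomy hk S hw with ⟨-, h⟩ | ⟨-, h⟩
    · exact h i hi
    · rw [← Finset.sum_subset S.subset_univ fun i _ hi => scaledProb_of_notMem hi] at h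
      have h1 : ∀ j ∈ S, scaledProb k S w j ≤ 1 := fun j _ => (scaledProb_mem_Icc hk S hw j).2
      have h2 : ∑ j ∈ S, (1 : ℝ) ≤ k := by simpa using hS
      exact (Finset.sum_eq_sum_iff_of_le h1).mp
        (le_antisymm (Finset.sum_le_sum h1) (h ▸ h2)) i hi
  · exact scaledProb_of_notMem hi

/-- The scaled probabilities are the weights, scaled and truncated at `1`. -/
theorem exists_scaledProb_eq_min {N k : ℕ} (hk : 1 ≤ k) {S : Finset (Fin N)} (hS : k ≤ S.card)
    {w : Fin N → ℝ} (hw : ∀ i, 0 < w i) :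
    (∃ c, 0 < c ∧ ∀ i ∈ S, scaledProb k S w i = min 1 (c * w i)) ∧
      ∑ i ∈ S, scaledProb k S w i = k := by
  have hsub := Finset.sum_subset S.subset_univ fun i _ hi =>
    scaledProb_of_notMem (k := k) (w := w) hi
  rcases scaledProb_dichotomy hk S hw with ⟨h1, h⟩ | h
  · have hne : S.Nonempty := Finset.card_pos.mp (by omega)
    -- All entries are `1` here, so any `c` with `c * w i ≥ 1` on `S` will do.
    refine ⟨⟨∑ j ∈ S, (w j)⁻¹, Finset.sum_pos (fun j _ => inv_pos.mpr (hw j)) hne,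
      fun i hi => ?_⟩, ?_⟩
    · rw [h i hi, min_eq_left]
      have : (w i)⁻¹ ≤ ∑ j ∈ S, (w j)⁻¹ :=
        Finset.single_le_sum (fun j _ => (inv_pos.mpr (hw j)).le) hi
      calc (1 : ℝ) = (w i)⁻¹ * w i := (inv_mul_cancel₀ (hw i).ne').symm
        _ ≤ _ := by have := (hw i).le; gcongr
    · rw [Finset.sum_congr rfl h]; simp; omega
  · rwa [hsub]

/-! ### Mixture decomposition -/

/-- A run of the mixture decomposition produces nonnegative coefficients of `k`-sets that
decompose the input vector. -/
theorem MixtureRun.spec {N k : ℕ} (hk : 1 ≤ k) {p : Fin N → ℝ} {D : Finset (Fin N) → ℝ}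
    (h : MixtureRun k p D) (hp0 : ∀ i, 0 ≤ p i) (hp1 : ∀ i, p i ≤ capLevel k p) :
    (∀ A, 0 ≤ D A) ∧ ∑ A, D A = capLevel k p ∧ ∀ i, ∑ A, (if i ∈ A then D A else 0) = p i := by
  have hk0 : (0 : ℝ) < k := by exact_mod_cast hk
  induction h with
  | done p hp =>
    push Not at hp
    have : ∀ i, p i = 0 := fun i => le_antisymm (hp i) (hp0 i)
    simp [capLevel, this]
  | pass p D r s l hp hcard hsupp hcap hs hl hD ih =>
    set q := min s (capLevel k p - l) with hq
    have hlj : ∀ j, j ∉ r → p j ≤ l := fun j hj => hl.2 (Or.inr ⟨j, hj, rfl⟩)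
    have hsi : ∀ i ∈ r, s ≤ p i := fun i hi => hs.2 ⟨i, hi, rfl⟩
    have hqs : q ≤ s := min_le_left _ _
    have hql : q ≤ capLevel k p - l := min_le_right _ _
    have hc0 : 0 ≤ capLevel k p := div_nonneg (Finset.sum_nonneg fun i _ => hp0 i) hk0.le
    have hq0 : 0 ≤ q := by
      refine le_min ?_ (sub_nonneg.mpr ?_)
      · obtain ⟨i, -, hi⟩ := hs.1
        exact hi ▸ hp0 i
      · rcases hl.1 with h | ⟨j, -, h⟩
        · rw [h]; exact hc0
        · rw [← h]; exact hp1 j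
    have hc' : capLevel k (fun i => p i - if i ∈ r then q else 0) = capLevel k p - q := by
      simp only [capLevel, Finset.sum_sub_distrib, Finset.sum_ite_mem, Finset.univ_inter,
        Finset.sum_const, hcard, nsmul_eq_mul]
      field_simp
    obtain ⟨h1, h2, h3⟩ := ih
      -- The invariants survive a pass. On `r` an entry and the cap both drop by `q ≤ s`; off `r` an
      -- entry is at most `l ≤ c - q`, with `c` the old cap.
      (fun i => by
        by_cases hi : i ∈ r
        · simp only [hi, if_true]; linarith [hsi i hi]
        · simp only [hi, if_false]; linarith [hp0 i])
      (fun i => by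
        rw [hc']
        by_cases hi : i ∈ r
        · simp only [hi, if_true]; linarith [hp1 i]
        · simp only [hi, if_false]; linarith [hlj i hi])
    refine ⟨fun A => add_nonneg (by split_ifs <;> simp [hq0]) (h1 A), ?_, fun i => ?_⟩
    · rw [Finset.sum_add_distrib, h2, hc', Fintype.sum_ite_eq']; ring
    · have : ∀ A : Finset (Fin N), (if i ∈ A then (if A = r then q else 0) + D A else 0) =
          (if A = r then if i ∈ r then q else 0 else 0) + if i ∈ A then D A else 0 := by
        intro A
        by_cases hA : A = r
        · subst hA; by_cases hi : i ∈ A <;> simp [hi]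
        · by_cases hi : i ∈ A <;> simp [hA, hi]
      simp_rw [this]
      rw [Finset.sum_add_distrib, h3, Fintype.sum_ite_eq']; ring

/-- The law of the played set given the available set has the scaled probabilities as marginals. -/
theorem playProb_spec {N k : ℕ} (hk : 1 ≤ k) (mix : MixtureRule N k) {w : Fin N → ℝ}
    (hw : ∀ i, 0 < w i) (S : Finset (Fin N)) :
    (∀ A, 0 ≤ playProb mix w S A) ∧ ∑ A, playProb mix w S A = 1 ∧
      ∀ i, ∑ A, (if i ∈ A then playProb mix w S A else 0) = scaledProb k S w i := by
  have hk0 : (k : ℝ) ≠ 0 := by exact_mod_cast (by omega : k ≠ 0)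
  by_cases hS : S.card < k
  · refine ⟨fun A => ?_, ?_, fun i => ?_⟩
    · simp only [playProb, hS, if_true]; split_ifs <;> simp
    · simp [playProb, hS]
    · rw [scaledProb_of_card_le hk hS.le hw]
      simp only [playProb, hS, if_true]
      rw [Finset.sum_eq_single S]
      · simp
      · intro A _ hA; simp [hA]
      · simp
  · have hsum := (exists_scaledProb_eq_min hk (not_lt.mp hS) hw).2
    rw [Finset.sum_subset S.subset_univ fun i _ hi => scaledProb_of_notMem hi] at hsum
    have hI := scaledProb_mem_Icc hk S hw
    have hc : capLevel k (scaledProb k S w) = 1 := by rw [capLevel, hsum, div_self hk0]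
    have := (mix.isRun _ hI hsum).spec hk (fun i => (hI i).1) (fun i => by rw [hc]; exact (hI i).2)
    rw [hc] at this
    simpa only [playProb, hS, if_false] using this

theorem weights_pos {N k : ℕ} (lam : ℕ → ℝ) (eta : ℝ) (loss : ℕ → Fin N → ℝ) (h : History N)
    (i : Fin N) : 0 < weights k lam eta loss h i := by
  induction h with
  | nil => simp [weights]
  | cons r h ih => exact mul_pos ih (Real.exp_pos _)

/-! ### Expectations -/

/-- Conditional expectation of a function of the next round, for the current weights `w`. -/
noncomputable def stepExp {N k : ℕ} (mix : MixtureRule N k) (a w : Fin N → ℝ)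
    (f : Round N → ℝ) : ℝ :=
  ∑ r : Round N, availProb a r.1 * playProb mix w r.1 r.2 * f r

theorem expectation_zero {N k : ℕ} (mix : MixtureRule N k) (lam : ℕ → ℝ) (eta : ℝ)
    (a : Fin N → ℝ) (loss : ℕ → Fin N → ℝ) (f : History N → ℝ) :
    expectation mix lam eta a loss 0 f = f [] := by
  rw [expectation, Fintype.sum_eq_single List.Vector.nil fun v hv =>
    absurd (List.Vector.eq_nil v) hv]
  simp [historyProb]

/-- Tower property: condition on all rounds but the most recent one, which is the head of the list.
-/
theorem expectation_succ {N k : ℕ} (mix : MixtureRule N k) (lam : ℕ → ℝ) (eta : ℝ)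
    (a : Fin N → ℝ) (loss : ℕ → Fin N → ℝ) (T : ℕ) (f : History N → ℝ) :
    expectation mix lam eta a loss (T + 1) f = expectation mix lam eta a loss T fun h =>
      stepExp mix a (weights k lam eta loss h) fun r => f (r :: h) := by
  let e : List.Vector (Round N) T × Round N ≃ List.Vector (Round N) (T + 1) :=
    { toFun := fun x => x.2 ::ᵥ x.1
      invFun := fun v => (v.tail, v.head)
      left_inv := fun x => by simp
      right_inv := fun v => by simp }
  simp only [expectation, stepExp]
  rw [← e.sum_comp, Fintype.sum_prod_type]
  refine Finset.sum_congr rfl fun v _ => ?_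
  rw [Finset.mul_sum]
  refine Finset.sum_congr rfl fun r _ => ?_
  simp only [e, Equiv.coe_fn_mk, List.Vector.toList_cons, historyProb]
  ring

section Step

variable {N k : ℕ} {mix : MixtureRule N k} {a w : Fin N → ℝ}

theorem stepExp_add (f g : Round N → ℝ) :
    stepExp mix a w (fun r => f r + g r) = stepExp mix a w f + stepExp mix a w g := by
  simp [stepExp, mul_add, Finset.sum_add_distrib]

theorem stepExp_const_mul (c : ℝ) (f : Round N → ℝ) :
    stepExp mix a w (fun r => c * f r) = c * stepExp mix a w f := by
  simp only [stepExp, Finset.mul_sum]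
  exact Finset.sum_congr rfl fun r _ => by ring

theorem stepExp_sum {ι : Type*} (s : Finset ι) (f : ι → Round N → ℝ) :
    stepExp mix a w (fun r => ∑ i ∈ s, f i r) = ∑ i ∈ s, stepExp mix a w (f i) := by
  simp only [stepExp, Finset.mul_sum]
  exact Finset.sum_comm

theorem stepExp_fst (hk : 1 ≤ k) (hw : ∀ i, 0 < w i) (f : Finset (Fin N) → ℝ) :
    stepExp mix a w (fun r => f r.1) = ∑ S, availProb a S * f S := by
  rw [stepExp, Fintype.sum_prod_type]
  refine Finset.sum_congr rfl fun S _ => ?_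
  dsimp only
  rw [← Finset.sum_mul, ← Finset.mul_sum, (playProb_spec hk mix hw S).2.1, mul_one]

theorem stepExp_const (hk : 1 ≤ k) (hw : ∀ i, 0 < w i) (c : ℝ) :
    stepExp mix a w (fun _ => c) = c := by
  rw [stepExp_fst hk hw fun _ => c, ← Finset.sum_mul, sum_availProb, one_mul]

/-- Given the available set, arm `i` is played with its scaled probability. The factor `f` may
depend on that set because the plug-in estimate already counts the current round. -/
theorem stepExp_ite_mem (hk : 1 ≤ k) (hw : ∀ i, 0 < w i) (i : Fin N)
    (f : Finset (Fin N) → ℝ) :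
    stepExp mix a w (fun r => if i ∈ r.2 then f r.1 else 0) =
      ∑ S, availProb a S * (scaledProb k S w i * f S) := by
  rw [stepExp, Fintype.sum_prod_type]
  refine Finset.sum_congr rfl fun S _ => ?_
  rw [← (playProb_spec hk mix hw S).2.2 i, Finset.sum_mul, Finset.mul_sum]
  refine Finset.sum_congr rfl fun A _ => ?_
  split_ifs <;> ring

end Step

section Expectation

variable {N k : ℕ} {mix : MixtureRule N k} {lam : ℕ → ℝ} {eta : ℝ} {a : Fin N → ℝ}
  {loss : ℕ → Fin N → ℝ}

theorem historyProb_nonneg (hk : 1 ≤ k) (ha : ∀ i, 0 ≤ a i ∧ a i ≤ 1) (h : History N) :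
    0 ≤ historyProb mix lam eta a loss h := by
  induction h with
  | nil => simp [historyProb]
  | cons r h ih =>
    exact mul_nonneg ih (mul_nonneg (availProb_nonneg ha _)
      ((playProb_spec hk mix (weights_pos lam eta loss h) r.1).1 r.2))

theorem expectation_mono (hk : 1 ≤ k) (ha : ∀ i, 0 ≤ a i ∧ a i ≤ 1) {T : ℕ}
    {f g : History N → ℝ} (hfg : ∀ h, h.length = T → f h ≤ g h) :
    expectation mix lam eta a loss T f ≤ expectation mix lam eta a loss T g :=
  Finset.sum_le_sum fun v _ => mul_le_mul_of_nonneg_left (hfg _ (by simp))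
    (historyProb_nonneg hk ha _)

theorem expectation_congr {T : ℕ}
    {f g : History N → ℝ} (hfg : ∀ h, h.length = T → f h = g h) :
    expectation mix lam eta a loss T f = expectation mix lam eta a loss T g :=
  Finset.sum_congr rfl fun v _ => by rw [hfg _ (by simp)]

theorem expectation_add (T : ℕ) (f g : History N → ℝ) :
    expectation mix lam eta a loss T (fun h => f h + g h) =
      expectation mix lam eta a loss T f + expectation mix lam eta a loss T g := by
  simp [expectation, mul_add, Finset.sum_add_distrib]

theorem expectation_const_mul (T : ℕ) (c : ℝ) (f : History N → ℝ) :
    expectation mix lam eta a loss T (fun h => c * f h) =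
      c * expectation mix lam eta a loss T f := by
  simp only [expectation, Finset.mul_sum]
  exact Finset.sum_congr rfl fun v _ => by ring

theorem expectation_sum {ι : Type*} (s : Finset ι) (T : ℕ) (f : ι → History N → ℝ) :
    expectation mix lam eta a loss T (fun h => ∑ i ∈ s, f i h) =
      ∑ i ∈ s, expectation mix lam eta a loss T (f i) := by
  simp only [expectation, Finset.mul_sum]
  exact Finset.sum_comm

theorem expectation_const (hk : 1 ≤ k) (T : ℕ) (c : ℝ) :
    expectation mix lam eta a loss T (fun _ => c) = c := by
  induction T with
  | zero => rw [expectation_zero]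
  | succ T ih =>
    rw [expectation_succ]
    simp_rw [stepExp_const hk (weights_pos lam eta loss _)]
    exact ih

/-- The expectation of an additive functional of the history is the sum of the expected
conditional increments. -/
theorem expectation_eq_sum (hk : 1 ≤ k) {F : History N → ℝ} {g : History N → Round N → ℝ}
    (h0 : F [] = 0) (hF : ∀ r h, F (r :: h) = F h + g h r) (T : ℕ) :
    expectation mix lam eta a loss T F = ∑ t ∈ Finset.range T,
      expectation mix lam eta a loss t fun h =>
        stepExp mix a (weights k lam eta loss h) (g h) := by
  induction T with
  | zero => simp [expectation_zero, h0]
  | succ T ih =>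
    rw [Finset.sum_range_succ, ← ih, expectation_succ, ← expectation_add]
    refine expectation_congr fun h _ => ?_
    simp_rw [hF]
    rw [stepExp_add, stepExp_const hk (weights_pos lam eta loss _)]

end Expectation

/-! ### Follow the regularised leader on the capped simplex -/

/-- Nonnegativity of the unnormalised relative entropy, from `log (y / x) ≤ y / x - 1`. -/
theorem sub_le_mul_log_sub {x y : ℝ} (hx : 0 ≤ x) (hy : 0 < y) :
    x - y ≤ x * (Real.log x - Real.log y) := by
  rcases hx.eq_or_lt with rfl | hx
  · simp [hy.le]
  · have h := Real.log_le_sub_one_of_pos (div_pos hy hx)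
    rw [Real.log_div hy.ne' hx.ne'] at h
    have h2 : x * (Real.log y - Real.log x) ≤ x * (y / x - 1) := by gcongr
    rw [mul_sub x (y / x), mul_div_cancel₀ y hx.ne'] at h2
    linarith

/-- Combine `exp z ≥ 1 + z` with `(1 - z + z²)(1 + z) = 1 + z³ ≥ 1`. -/
theorem exp_neg_le_one_sub_add_sq {z : ℝ} (hz : 0 ≤ z) : Real.exp (-z) ≤ 1 - z + z ^ 2 := by
  have h1 : Real.exp (-z) * Real.exp z = 1 := by rw [← Real.exp_add]; simp
  have h2 := Real.add_one_le_exp z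
  have h3 : Real.exp (-z) * (z + 1) ≤ 1 :=
    (mul_le_mul_of_nonneg_left h2 (Real.exp_pos _).le).trans_eq h1
  have h4 : 1 ≤ (1 - z + z ^ 2) * (z + 1) := by nlinarith [pow_nonneg hz 3]
  exact le_of_mul_le_mul_right (h3.trans h4) (by linarith)

/-- One step of entropic regularisation: `q` minimises the potential for the weights `w` over
the vectors with entries at most `1` and the same total mass. -/
theorem potential_step {ι : Type*} {S : Finset ι} {w q x z : ι → ℝ} {c : ℝ} (hc : 0 < c)
    (hw : ∀ i, 0 < w i) (hq : ∀ i ∈ S, q i = min 1 (c * w i))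
    (hx : ∀ i ∈ S, 0 ≤ x i ∧ x i ≤ 1) (hsum : ∑ i ∈ S, x i = ∑ i ∈ S, q i)
    (hz : ∀ i ∈ S, 0 ≤ z i) :
    ∑ i ∈ S, q i * (Real.log (q i) - Real.log (w i)) + ∑ i ∈ S, q i * z i -
        ∑ i ∈ S, q i * z i ^ 2 ≤
      ∑ i ∈ S, x i * (Real.log (x i) - Real.log (w i) + z i) := by
  -- The inequality holds termwise once a Lagrange multiplier `log c + 1` for the mass constraint is
  -- added; its contribution sums to zero.
  have key : ∀ i ∈ S, q i * (Real.log (q i) - Real.log (w i)) + q i * z i - q i * z i ^ 2 +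
      (Real.log c + 1) * (x i - q i) ≤ x i * (Real.log (x i) - Real.log (w i) + z i) := by
    intro i hi
    have hcw : 0 < c * w i := mul_pos hc (hw i)
    have hqi : 0 < q i := by rw [hq i hi]; exact lt_min one_pos hcw
    have h1 := sub_le_mul_log_sub (hx i hi).1 (mul_pos hqi (Real.exp_pos (-z i)))
    rw [Real.log_mul hqi.ne' (Real.exp_pos _).ne', Real.log_exp] at h1
    have h2 : q i * Real.exp (-z i) ≤ q i * (1 - z i + z i ^ 2) := by
      have := exp_neg_le_one_sub_add_sq (hz i hi)
      gcongr
    -- Optimality condition: `log (q / w)` equals `log c` below the cap. At the cap it is at most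
    -- `log c`, while `x - q ≤ 0`.
    have h3 : Real.log c * (x i - q i) ≤ (x i - q i) * (Real.log (q i) - Real.log (w i)) := by
      rcases le_total 1 (c * w i) with h | h
      · rw [hq i hi, min_eq_left h]
        have h4 := Real.log_nonneg h
        rw [Real.log_mul hc.ne' (hw i).ne'] at h4
        have h5 := (hx i hi).2
        rw [Real.log_one]
        nlinarith
      · rw [hq i hi, min_eq_right h, Real.log_mul hc.ne' (hw i).ne']
        apply le_of_eq; ring
    nlinarith
  have := Finset.sum_le_sum key
  rw [Finset.sum_add_distrib, Finset.sum_sub_distrib, Finset.sum_add_distrib, ← Finset.mul_sum,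
    Finset.sum_sub_distrib, hsum, sub_self, mul_zero, add_zero] at this
  exact this

/-- The entropy of a nonnegative vector of total mass `k` supported on `S`. -/
theorem neg_mul_log_le_sum_mul_log {ι : Type*} {S : Finset ι} {q : ι → ℝ} {k : ℝ} (hk : 0 < k)
    (hS : S.Nonempty) (hq : ∀ i ∈ S, 0 ≤ q i) (hsum : ∑ i ∈ S, q i = k) :
    -(k * Real.log (S.card / k)) ≤ ∑ i ∈ S, q i * Real.log (q i) := by
  have hc : (0 : ℝ) < S.card := by exact_mod_cast Finset.card_pos.mpr hS
  -- Compare with the constant vector of the same mass.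
  have h := Finset.sum_le_sum fun i hi => sub_le_mul_log_sub (hq i hi) (div_pos hk hc)
  simp_rw [mul_sub] at h
  rw [Finset.sum_sub_distrib, Finset.sum_sub_distrib, ← Finset.sum_mul, hsum, Finset.sum_const,
    nsmul_eq_mul, mul_div_cancel₀ _ hc.ne', sub_self] at h
  rw [← inv_div, Real.log_inv] at h
  linarith

/-- The additive functional of the history with increments `g`. -/
def pathSum {N : ℕ} (g : History N → Round N → ℝ) : History N → ℝ
  | [] => 0
  | r :: h => pathSum g h + g h r

/-- The regret bound for the available set `S` and the comparator `U`, along a history. -/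
theorem pathSum_regret_le {N k T : ℕ} (hk : 1 ≤ k) (hkN : k ≤ N) {lam : ℕ → ℝ} {eta : ℝ}
    (heta : 0 < eta) {loss : ℕ → Fin N → ℝ}
    (hest : ∀ (h : History N) r i, h.length < T →
      0 ≤ estLoss k lam loss (weights k lam eta loss h) r h i)
    {S U : Finset (Fin N)} (hUS : U ⊆ S) (hU : U.card = min k S.card)
    (h : History N) (hT : h.length ≤ T) :
    pathSum (fun h r =>
        ∑ i, ((scaledProb k S (weights k lam eta loss h) i - if i ∈ U then 1 else 0) *
            estLoss k lam loss (weights k lam eta loss h) r h i -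
          eta * (scaledProb k S (weights k lam eta loss h) i *
            estLoss k lam loss (weights k lam eta loss h) r h i ^ 2))) h ≤
      k * Real.log (N / k) / eta := by
  have hk0 : (0 : ℝ) < k := by exact_mod_cast hk
  have hlog : 0 ≤ Real.log ((N : ℝ) / k) :=
    Real.log_nonneg (by rw [le_div_iff₀ hk0, one_mul]; exact_mod_cast hkN)
  set W := weights k lam eta loss with hW
  set q : History N → Fin N → ℝ := fun h => scaledProb k S (W h) with hq
  set e : History N → Round N → Fin N → ℝ := fun h r => estLoss k lam loss (W h) r h with he
  change pathSum (fun h r => ∑ i, ((q h i - if i ∈ U then 1 else 0) * e h r i -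
    eta * (q h i * e h r i ^ 2))) h ≤ _
  have hWpos : ∀ h i, 0 < W h i := weights_pos lam eta loss
  have hout : ∀ h i, i ∉ S → q h i = 0 := fun h i hi => scaledProb_of_notMem hi
  have hqI : ∀ h i, 0 ≤ q h i ∧ q h i ≤ 1 := fun h => scaledProb_mem_Icc hk S (hWpos h)
  rcases le_total S.card k with hS | hS
  -- Learner and comparator both play all of `S`, so only the negative second-order terms remain.
  · have hUeq : U = S := Finset.eq_of_subset_of_card_le hUS (by omega)
    refine le_trans ?_ (by positivity : 0 ≤ k * Real.log (N / k) / eta)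
    clear hT
    induction h with
    | nil => simp [pathSum]
    | cons r h ih =>
      refine add_nonpos ih (Finset.sum_nonpos fun i _ => ?_)
      rw [hq, hUeq]
      simp only
      rw [scaledProb_of_card_le hk hS (hWpos h) i, sub_self, zero_mul, zero_sub, neg_nonpos]
      split_ifs <;> positivity
  · have hUk : U.card = k := by omega
    have hne : S.Nonempty := Finset.card_pos.mp (by omega)
    have hmin := fun h => exists_scaledProb_eq_min hk hS (hWpos h)
    have hlogW : ∀ r h i, Real.log (W (r :: h) i) = Real.log (W h i) - eta * e h r i := by
      intro r h i
      rw [hW, weights, Real.log_mul (weights_pos lam eta loss h i).ne' (Real.exp_pos _).ne',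
        Real.log_exp]
      simp only [he, hW]; ring
    have hW0 : ∀ i, W [] i = 1 := fun i => rfl
    -- Since `-log W` is `eta` times the cumulative estimated loss, `Φ` is the minimum of the
    -- regularised objective over the capped simplex on `S`.
    set Φ : History N → ℝ := fun h =>
      ∑ i ∈ S, q h i * (Real.log (q h i) - Real.log (W h i)) with hΦ
    have hΦ0 : -(k * Real.log (N / k)) ≤ Φ [] := by
      have h1 := neg_mul_log_le_sum_mul_log hk0 hne (fun i _ => (hqI [] i).1) (hmin []).2
      have h2 : Φ [] = ∑ i ∈ S, q [] i * Real.log (q [] i) :=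
        Finset.sum_congr rfl fun i _ => by rw [hW0, Real.log_one, sub_zero]
      rw [h2]
      refine le_trans ?_ h1
      have hc : (0 : ℝ) < S.card := by exact_mod_cast Finset.card_pos.mpr hne
      have hcN : (S.card : ℝ) ≤ N := by exact_mod_cast (by simpa using S.card_le_univ)
      exact neg_le_neg (mul_le_mul_of_nonneg_left (Real.log_le_log (div_pos hc hk0)
        (div_le_div_of_nonneg_right hcN hk0.le)) hk0.le)
    -- Minimality tested against the indicator of `U`, whose entropy vanishes; no new loss is added
    -- (`z = 0`).
    have hΦU : Φ h ≤ ∑ i ∈ U, -Real.log (W h i) := by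
      obtain ⟨⟨c, hc, hqc⟩, hsum⟩ := hmin h
      have := potential_step (x := fun i => if i ∈ U then 1 else 0) (z := fun _ => 0) hc
        (hWpos h) hqc (fun i _ => by split_ifs <;> norm_num)
        (by rw [hsum, Finset.sum_ite_mem, Finset.inter_eq_right.mpr hUS]; simp [hUk])
        (fun _ _ => le_rfl)
      have h2 : ∀ i, (if i ∈ U then (1 : ℝ) else 0) *
          (Real.log (if i ∈ U then 1 else 0) - Real.log (W h i) + 0) =
          if i ∈ U then -Real.log (W h i) else 0 := by
        intro i; split_ifs <;> simp
      simp_rw [h2] at this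
      rw [Finset.sum_ite_mem, Finset.inter_eq_right.mpr hUS] at this
      simpa using this
    -- Here the competitor is the next minimiser.
    have hΦstep : ∀ h r, h.length < T →
        Φ h + eta * ∑ i, q h i * e h r i - eta * (eta * ∑ i, q h i * e h r i ^ 2) ≤
          Φ (r :: h) := by
      intro h r hh
      obtain ⟨⟨c, hc, hqc⟩, hsum⟩ := hmin h
      have := potential_step (x := q (r :: h)) (z := fun i => eta * e h r i) hc
        (hWpos h) hqc (fun i _ => hqI _ i) (by rw [hsum]; exact (hmin _).2)
        (fun i _ => mul_nonneg heta.le (hest h r i hh))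
      rw [← Finset.sum_subset S.subset_univ fun i _ hi => by rw [hout h i hi, zero_mul],
        ← Finset.sum_subset S.subset_univ fun i _ hi => by rw [hout h i hi, zero_mul],
        Finset.mul_sum, Finset.mul_sum, Finset.mul_sum]
      convert this using 1
      · congr 1
        · congr 1
          exact Finset.sum_congr rfl fun i _ => by ring
        · exact Finset.sum_congr rfl fun i _ => by ring
      · refine Finset.sum_congr rfl fun i _ => ?_
        rw [hlogW]; ring
    rw [le_div_iff₀ heta]
    have key : Φ [] + eta * pathSum (fun h r => ∑ i, ((q h i - if i ∈ U then 1 else 0) * e h r i -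
        eta * (q h i * e h r i ^ 2))) h ≤ Φ h - ∑ i ∈ U, -Real.log (W h i) := by
      clear hΦU
      induction h with
      | nil => simp [pathSum, hW0]
      | cons r h ih =>
        simp only [List.length_cons] at hT
        have h1 := hΦstep h r (by omega)
        have h2 := ih (by omega)
        simp only [hlogW, pathSum, Finset.sum_sub_distrib, sub_mul, Finset.sum_neg_distrib,
          ← Finset.mul_sum, ite_mul, one_mul, zero_mul, Finset.sum_ite_mem,
          Finset.univ_inter] at h2 ⊢
        linarith
    linarith

/-! ### Concentration of the empirical availabilities -/

/-- For a centred variable the linear term integrates to zero, leaving a sub-Gaussian bound. -/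
theorem exp_le_self_add_exp_sq (x : ℝ) : Real.exp x ≤ x + Real.exp (x ^ 2) := by
  have h := Real.add_one_le_exp (x ^ 2)
  rcases le_total |x| 1 with h1 | h1
  · have := (abs_le.mp (Real.abs_exp_sub_one_sub_id_le h1)).2
    linarith
  · rcases le_abs.mp h1 with h2 | h2
    · have : Real.exp x ≤ Real.exp (x ^ 2) := Real.exp_le_exp.mpr (by nlinarith)
      linarith
    · have : Real.exp x ≤ 1 := Real.exp_le_one_iff.mpr (by linarith)
      nlinarith

/-- The moment generating function of a centred Bernoulli variable. -/
theorem bernoulli_mgf_le {p : ℝ} (hp : 0 ≤ p ∧ p ≤ 1) (s : ℝ) :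
    p * Real.exp (s * (1 - p)) + (1 - p) * Real.exp (s * -p) ≤ Real.exp (s ^ 2) := by
  have h1 : Real.exp (s * (1 - p)) ≤ s * (1 - p) + Real.exp (s ^ 2) := by
    refine (exp_le_self_add_exp_sq _).trans (add_le_add le_rfl (Real.exp_le_exp.mpr ?_))
    rw [mul_pow]
    exact mul_le_of_le_one_right (sq_nonneg s) (by nlinarith)
  have h2 : Real.exp (s * -p) ≤ s * -p + Real.exp (s ^ 2) := by
    refine (exp_le_self_add_exp_sq _).trans (add_le_add le_rfl (Real.exp_le_exp.mpr ?_))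
    rw [mul_pow]
    exact mul_le_of_le_one_right (sq_nonneg s) (by nlinarith)
  have h3 : p * Real.exp (s * (1 - p)) ≤ p * (s * (1 - p) + Real.exp (s ^ 2)) := by
    have := hp.1; gcongr
  have h4 : (1 - p) * Real.exp (s * -p) ≤ (1 - p) * (s * -p + Real.exp (s ^ 2)) := by
    have : 0 ≤ 1 - p := by linarith [hp.2]
    gcongr
  linarith

theorem empAvail_mem_Icc {N : ℕ} (h : History N) (i : Fin N) :
    0 ≤ empAvail h i ∧ empAvail h i ≤ 1 :=
  ⟨by unfold empAvail; positivity,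
    div_le_one_of_le₀ (by exact_mod_cast List.countP_le_length) (by positivity)⟩

/-- The plug-in estimate misses the selection probability by more than the bias parameter can
compensate. -/
def IsBad {N : ℕ} (lam : ℕ → ℝ) (a : Fin N → ℝ) (h : History N) : Prop :=
  lam h.length < min 1 (∑ i, |empAvail h i - a i|)

open Classical in
/-- The indicator of `IsBad`. -/
noncomputable def badInd {N : ℕ} (lam : ℕ → ℝ) (a : Fin N → ℝ) (h : History N) : ℝ :=
  if IsBad lam a h then 1 else 0

section

variable {N k : ℕ} {mix : MixtureRule N k} {lam : ℕ → ℝ} {eta : ℝ} {a : Fin N → ℝ}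
  {loss : ℕ → Fin N → ℝ}

/-- The availability of the next round does not depend on the history, so each round contributes a
factor of at most `exp (s ^ 2)`, however adaptive the play. -/
theorem expectation_exp_count_le (hk : 1 ≤ k) (ha : ∀ i, 0 ≤ a i ∧ a i ≤ 1) (i : Fin N) (s : ℝ)
    (T : ℕ) :
    expectation mix lam eta a loss T (fun h =>
      Real.exp (s * ((h.countP fun r => i ∈ r.1 : ℝ) - h.length * a i))) ≤
      Real.exp (s ^ 2 * T) := by
  induction T with
  | zero => simp [expectation_zero]
  | succ T ih =>
    have h1 : ∀ (h : History N) (r : Round N),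
        Real.exp (s * (((r :: h).countP fun r => i ∈ r.1 : ℝ) - (r :: h).length * a i)) =
        Real.exp (s * ((h.countP fun r => i ∈ r.1 : ℝ) - h.length * a i)) *
          (if i ∈ r.1 then Real.exp (s * (1 - a i)) else Real.exp (s * -a i)) := by
      intro h r
      by_cases hi : i ∈ r.1
      · rw [if_pos hi, ← Real.exp_add, List.countP_cons_of_pos (by simpa using hi)]
        push_cast [List.length_cons]; congr 1; ring
      · rw [if_neg hi, ← Real.exp_add, List.countP_cons_of_neg (by simpa using hi)]
        push_cast [List.length_cons]; congr 1; ring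
    rw [expectation_succ]
    simp_rw [h1, stepExp_const_mul]
    have h2 : ∀ h : History N, stepExp mix a (weights k lam eta loss h)
        (fun r => if i ∈ r.1 then Real.exp (s * (1 - a i)) else Real.exp (s * -a i)) ≤
        Real.exp (s ^ 2) := by
      intro h
      rw [stepExp_fst hk (weights_pos lam eta loss h)
        fun S => if i ∈ S then Real.exp (s * (1 - a i)) else Real.exp (s * -a i),
        sum_availProb_mul_ite]
      exact bernoulli_mgf_le (ha i) s
    calc _ ≤ expectation mix lam eta a loss T (fun h => Real.exp (s ^ 2) *
          Real.exp (s * ((h.countP fun r => i ∈ r.1 : ℝ) - h.length * a i))) := by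
          refine expectation_mono hk ha fun h _ => ?_
          rw [mul_comm]
          exact mul_le_mul_of_nonneg_right (h2 h) (Real.exp_pos _).le
      _ ≤ Real.exp (s ^ 2) * Real.exp (s ^ 2 * T) := by
          rw [expectation_const_mul]; gcongr
      _ = _ := by rw [← Real.exp_add]; push_cast; congr 1; ring

/-- A bad history has `lam t < 1`, hence `ℓ¹` error above `N * ε`, so some arm is off by more than
`ε`. The rest is a union bound over arms and signs with Chernoff parameter `± ε / 2`. -/
theorem expectation_badInd_le (hk : 1 ≤ k) (ha : ∀ i, 0 ≤ a i ∧ a i ≤ 1) {t : ℕ} (ht : 1 ≤ t)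
    {ε : ℝ} (hε : 0 < ε) (hlam : lam t < 1 → N * ε ≤ lam t) :
    expectation mix lam eta a loss t (badInd lam a) ≤ 2 * N * Real.exp (-(t * ε ^ 2 / 4)) := by
  have ht0 : (0 : ℝ) < t := by exact_mod_cast ht
  set X : Fin N → ℝ → History N → ℝ := fun i s h =>
    Real.exp (s * ((h.countP fun r => i ∈ r.1 : ℝ) - h.length * a i)) with hX
  have hXpos : ∀ i s h, 0 < X i s h := fun i s h => Real.exp_pos _
  set m := Real.exp (-(t * ε ^ 2 / 2)) with hm
  have h1 : ∀ h : History N, h.length = t →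
      badInd lam a h ≤ ∑ i, m * (X i (ε / 2) h + X i (-(ε / 2)) h) := by
    intro h hh
    have hnn : ∀ i, 0 ≤ m * (X i (ε / 2) h + X i (-(ε / 2)) h) := fun i =>
      mul_nonneg (Real.exp_pos _).le (add_nonneg (hXpos _ _ _).le (hXpos _ _ _).le)
    rw [badInd]
    split_ifs with hbad
    swap
    · exact Finset.sum_nonneg fun i _ => hnn i
    rw [IsBad, hh, lt_min_iff] at hbad
    obtain ⟨i, hi⟩ : ∃ i, ε < |empAvail h i - a i| := by
      by_contra! hle
      have : ∑ i, |empAvail h i - a i| ≤ ∑ _i : Fin N, ε := Finset.sum_le_sum fun i _ => hle i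
      simp at this
      linarith [hlam hbad.1]
    refine le_trans ?_ (Finset.single_le_sum (fun i _ => hnn i) (Finset.mem_univ i))
    have hc : (h.countP fun r => i ∈ r.1 : ℝ) - h.length * a i = t * (empAvail h i - a i) := by
      rw [empAvail, hh]; field_simp
    have hme : ∀ y, t * ε ^ 2 / 2 ≤ y → 1 ≤ m * Real.exp y := fun y hy => by
      rw [hm, ← Real.exp_add]; exact Real.one_le_exp (by linarith)
    rcases lt_abs.mp hi with hi | hi
    · calc 1 ≤ m * X i (ε / 2) h := hme _ (by
            rw [hc]
            have : t * ε * ε ≤ t * ε * (empAvail h i - a i) := by gcongr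
            linarith)
        _ ≤ _ := by have := (Real.exp_pos (-(t * ε ^ 2 / 2))).le
                    gcongr
                    linarith [hXpos i (-(ε / 2)) h]
    · calc 1 ≤ m * X i (-(ε / 2)) h := hme _ (by
            rw [hc]
            have : t * ε * ε ≤ t * ε * -(empAvail h i - a i) := by gcongr
            linarith)
        _ ≤ _ := by have := (Real.exp_pos (-(t * ε ^ 2 / 2))).le
                    gcongr
                    linarith [hXpos i (ε / 2) h]
  have h2 : ∀ i s, s ^ 2 = ε ^ 2 / 4 →
      m * expectation mix lam eta a loss t (X i s) ≤ Real.exp (-(t * ε ^ 2 / 4)) := by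
    intro i s hs
    calc _ ≤ m * Real.exp (s ^ 2 * t) :=
          mul_le_mul_of_nonneg_left (expectation_exp_count_le hk ha i s t) (Real.exp_pos _).le
      _ = _ := by rw [hm, ← Real.exp_add, hs]; congr 1; ring
  refine (expectation_mono hk ha h1).trans ?_
  rw [expectation_sum]
  calc _ ≤ ∑ _i : Fin N, 2 * Real.exp (-(t * ε ^ 2 / 4)) := by
        refine Finset.sum_le_sum fun i _ => ?_
        rw [expectation_const_mul, expectation_add, mul_add]
        linarith [h2 i (ε / 2) (by ring), h2 i (-(ε / 2)) (by ring)]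
    _ = _ := by simp; ring

end

/-! ### Bias and variance of the loss estimates -/

/-- Bias and variance of the estimated loss of one arm. Here `x` is the selection probability
given the available set, `Q` the plug-in estimate of its mean `q`, and `b` the indicator that this
estimate is off by more than `lam`. -/
theorem estimate_bias_variance {ι : Type*} [Fintype ι] {P x Q b : ι → ℝ} {q u ℓ lam eta : ℝ}
    (hP : ∀ S, 0 ≤ P S) (hP1 : ∑ S, P S = 1) (hx : ∀ S, 0 ≤ x S ∧ x S ≤ 1) (hQ : ∀ S, 0 ≤ Q S)
    (hb : ∀ S, b S = 1 ∨ b S = 0 ∧ |Q S - q| ≤ lam) (hq : q = ∑ S, P S * x S)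
    (hu : 0 ≤ u ∧ u ≤ 1) (hℓ : 0 ≤ ℓ ∧ ℓ ≤ 1) (hlam : 0 < lam ∧ lam ≤ 1)
    (heta : 0 ≤ eta ∧ eta ≤ 1) :
    (q - u) * ℓ ≤ ((q - u) * (∑ S, P S * (x S * (ℓ / (Q S + lam)))) -
      eta * (q * ∑ S, P S * (x S * (ℓ / (Q S + lam)) ^ 2))) +
      (2 * lam + eta + 3 / lam ^ 2 * ∑ S, P S * b S) := by
  obtain ⟨hl0, hl1⟩ := hlam
  have hq0 : 0 ≤ q := hq ▸ Finset.sum_nonneg fun S _ => mul_nonneg (hP S) (hx S).1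
  have hq1 : q ≤ 1 := by
    rw [hq, ← hP1]
    exact Finset.sum_le_sum fun S _ => mul_le_of_le_one_right (hP S) (hx S).2
  have hb0 : ∀ S, 0 ≤ b S := fun S => by rcases hb S with h | ⟨h, -⟩ <;> rw [h]; norm_num
  have hβ : 0 ≤ ∑ S, P S * b S := Finset.sum_nonneg fun S _ => mul_nonneg (hP S) (hb0 S)
  set β := ∑ S, P S * b S with hβdef
  have hg0 : ∀ S, 0 ≤ ℓ / (Q S + lam) := fun S =>
    div_nonneg hℓ.1 (add_nonneg (hQ S) hl0.le)
  have hgl : ∀ S, ℓ / (Q S + lam) ≤ 1 / lam := fun S =>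
    div_le_div₀ zero_le_one hℓ.2 hl0 (by linarith [hQ S])
  -- the estimate is not much smaller than the loss
  have h1 : ℓ / (q + 2 * lam) * (q - β) ≤ ∑ S, P S * (x S * (ℓ / (Q S + lam))) := by
    -- Subtracting `b` makes the summand nonpositive on bad sets; on good sets the denominator is at
    -- most `q + 2 * lam`.
    have h0 : q - β = ∑ S, P S * (x S - b S) := by
      simp only [mul_sub, Finset.sum_sub_distrib, ← hq, hβdef]
    rw [h0, Finset.mul_sum]
    refine Finset.sum_le_sum fun S _ => ?_
    rw [mul_left_comm]
    refine mul_le_mul_of_nonneg_left ?_ (hP S)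
    have hr : 0 ≤ ℓ / (q + 2 * lam) := div_nonneg hℓ.1 (by linarith)
    rcases hb S with h | ⟨h, hd⟩
    · rw [h]
      exact (mul_nonpos_of_nonneg_of_nonpos hr (by linarith [(hx S).2])).trans
        (mul_nonneg (hx S).1 (hg0 S))
    · rw [h, sub_zero, mul_comm]
      refine mul_le_mul_of_nonneg_left ?_ (hx S).1
      have := (abs_le.mp hd).2
      exact div_le_div_of_nonneg_left hℓ.1 (by linarith [hQ S]) (by linarith)
  have h1' : q * ℓ - q * (∑ S, P S * (x S * (ℓ / (Q S + lam)))) ≤ 2 * lam + β := by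
    have h2 : q * (ℓ / (q + 2 * lam) * (q - β)) ≤
        q * ∑ S, P S * (x S * (ℓ / (Q S + lam))) := mul_le_mul_of_nonneg_left h1 hq0
    have h3 : q * ℓ - q * (ℓ / (q + 2 * lam) * (q - β)) =
        ℓ * (q / (q + 2 * lam)) * (2 * lam + β) := by
      have : q + 2 * lam ≠ 0 := by linarith
      field_simp; ring
    have h4 : q / (q + 2 * lam) ≤ 1 := div_le_one_of_le₀ (by linarith) (by linarith)
    have h5 : 0 ≤ q / (q + 2 * lam) := div_nonneg hq0 (by linarith)
    have h6 : ℓ * (q / (q + 2 * lam)) * (2 * lam + β) ≤ 2 * lam + β :=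
      mul_le_of_le_one_left (by linarith) (mul_le_one₀ hℓ.2 h5 h4)
    linarith
  have hzero : q = 0 → ∀ S, P S * x S = 0 := fun h S =>
    (Finset.sum_eq_zero_iff_of_nonneg fun S _ => mul_nonneg (hP S) (hx S).1).mp
      (hq ▸ h) S (Finset.mem_univ S)
  have hgq : ∀ S, b S = 0 ∧ |Q S - q| ≤ lam → 0 < q → ℓ / (Q S + lam) ≤ ℓ / q := by
    rintro S ⟨-, hd⟩ hqp
    have := (abs_le.mp hd).1
    exact div_le_div_of_nonneg_left hℓ.1 hqp (by linarith)
  -- the estimate is not much larger than the loss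
  have h2 : ∑ S, P S * (x S * (ℓ / (Q S + lam))) ≤ ℓ + 1 / lam * β := by
    rcases hq0.eq_or_lt with h | hqp
    · rw [Finset.sum_eq_zero fun S _ => by rw [← mul_assoc, hzero h.symm S, zero_mul]]
      have := hℓ.1
      positivity
    · have h3 : ℓ = ℓ / q * ∑ S, P S * x S := by rw [← hq]; field_simp
      conv_rhs => rw [h3]
      rw [hβdef, Finset.mul_sum, Finset.mul_sum, ← Finset.sum_add_distrib]
      refine Finset.sum_le_sum fun S _ => ?_
      rw [show ℓ / q * (P S * x S) + 1 / lam * (P S * b S) =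
        P S * (x S * (ℓ / q) + 1 / lam * b S) by ring]
      refine mul_le_mul_of_nonneg_left ?_ (hP S)
      have hlq : 0 ≤ ℓ / q := div_nonneg hℓ.1 hq0
      rcases hb S with h | h
      · rw [h, mul_one]
        have h4 := mul_nonneg (hx S).1 hlq
        have h5 := mul_le_of_le_one_left (hg0 S) (hx S).2
        linarith [hgl S]
      · rw [h.1, mul_zero, add_zero]
        exact mul_le_mul_of_nonneg_left (hgq S h hqp) (hx S).1
  -- the second moment
  have h3 : q * ∑ S, P S * (x S * (ℓ / (Q S + lam)) ^ 2) ≤ 1 + 1 / lam ^ 2 * β := by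
    rcases hq0.eq_or_lt with h | hqp
    · rw [← h, zero_mul]; positivity
    -- On good sets the squared estimate is at most `1 / q ^ 2`; the mean of `x` and the outer
    -- factor supply the two powers of `q` that cancel it.
    · have h4 : ∑ S, P S * (x S * (ℓ / (Q S + lam)) ^ 2) ≤
          1 / q ^ 2 * q + 1 / lam ^ 2 * β := by
        have h5 : q = ∑ S, P S * x S := hq
        conv_rhs => enter [1, 2]; rw [h5]
        rw [hβdef, Finset.mul_sum, Finset.mul_sum, ← Finset.sum_add_distrib]
        refine Finset.sum_le_sum fun S _ => ?_
        rw [show 1 / q ^ 2 * (P S * x S) + 1 / lam ^ 2 * (P S * b S) =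
          P S * (x S * (1 / q ^ 2) + 1 / lam ^ 2 * b S) by ring]
        refine mul_le_mul_of_nonneg_left ?_ (hP S)
        rcases hb S with h | h
        · rw [h, mul_one]
          have h6 : (ℓ / (Q S + lam)) ^ 2 ≤ 1 / lam ^ 2 := by
            rw [← one_div_pow]; exact pow_le_pow_left₀ (hg0 S) (hgl S) 2
          have h7 : 0 ≤ x S * (1 / q ^ 2) := mul_nonneg (hx S).1 (by positivity)
          have h8 := mul_le_of_le_one_left (sq_nonneg (ℓ / (Q S + lam))) (hx S).2
          linarith
        · rw [h.1, mul_zero, add_zero, ← one_div_pow]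
          refine mul_le_mul_of_nonneg_left (pow_le_pow_left₀ (hg0 S) ?_ 2) (hx S).1
          exact (hgq S h hqp).trans (div_le_div_of_nonneg_right hℓ.2 hq0)
      calc _ ≤ q * (1 / q ^ 2 * q + 1 / lam ^ 2 * β) := mul_le_mul_of_nonneg_left h4 hq0
        _ = 1 + q * (1 / lam ^ 2 * β) := by field_simp
        _ ≤ _ := by
          have : 0 ≤ 1 / lam ^ 2 * β := by positivity
          linarith [mul_le_of_le_one_left this hq1]
  -- The bad sets cost `β`, `β / lam` and `β / lam ^ 2` in the three estimates; bounding each by the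
  -- last gives the factor `3`.
  have hinv : 1 ≤ 1 / lam := by rw [le_div_iff₀ hl0]; linarith
  have hinv2 : 1 / lam ^ 2 = 1 / lam * (1 / lam) := by rw [← one_div_pow, sq]
  have h4 : u * ∑ S, P S * (x S * (ℓ / (Q S + lam))) ≤ u * ℓ + 1 / lam ^ 2 * β := by
    have h5 : 0 ≤ 1 / lam * β := by positivity
    have h6 : 1 / lam * β ≤ 1 / lam ^ 2 * β := by
      rw [hinv2, mul_assoc]; exact le_mul_of_one_le_left h5 hinv
    have h7 := mul_le_mul_of_nonneg_left h2 hu.1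
    have h8 := mul_le_of_le_one_left h5 hu.2
    linarith
  have h5 : eta * (q * ∑ S, P S * (x S * (ℓ / (Q S + lam)) ^ 2)) ≤ eta + 1 / lam ^ 2 * β := by
    have h6 := mul_le_mul_of_nonneg_left h3 heta.1
    have h7 : 0 ≤ 1 / lam ^ 2 * β := by positivity
    have h8 := mul_le_of_le_one_left h7 heta.2
    linarith
  have h6 : β ≤ 1 / lam ^ 2 * β := by
    refine le_mul_of_one_le_left hβ ?_
    rw [hinv2]; exact one_le_mul_of_one_le_of_one_le hinv hinv
  have h7 : 3 / lam ^ 2 * β = 3 * (1 / lam ^ 2 * β) := by ring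
  rw [h7]
  linarith

/-! ### From estimated to actual regret -/

/-- Probability that arm `i` is available and selected, for the weights `w`. -/
noncomputable def jointProb {N : ℕ} (k : ℕ) (a w : Fin N → ℝ) (i : Fin N) : ℝ :=
  ∑ S, availProb a S * scaledProb k S w i

/-- Probability that the policy `π` plays arm `i`. -/
noncomputable def policyProb {N : ℕ} (a : Fin N → ℝ) (π : Finset (Fin N) → Finset (Fin N))
    (i : Fin N) : ℝ :=
  ∑ S, availProb a S * if i ∈ π S then 1 else 0

/-- Increment of the estimated regret, less the variance term. -/
noncomputable def estRegretIncr {N : ℕ} (k : ℕ) (lam : ℕ → ℝ) (eta : ℝ) (a : Fin N → ℝ)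
    (loss : ℕ → Fin N → ℝ) (π : Finset (Fin N) → Finset (Fin N)) (h : History N)
    (r : Round N) : ℝ :=
  ∑ i, ((jointProb k a (weights k lam eta loss h) i - policyProb a π i) *
      estLoss k lam loss (weights k lam eta loss h) r h i -
    eta * (jointProb k a (weights k lam eta loss h) i *
      estLoss k lam loss (weights k lam eta loss h) r h i ^ 2))

/-- The frequencies ignore the played set, so `∅` can stand in for it and the denominator is
determined by the available set. -/
theorem jointEst_cons_congr {N k : ℕ} (w : Fin N → ℝ) (S A : Finset (Fin N)) (h : History N)
    (i : Fin N) : jointEst k w ((S, A) :: h) i = jointEst k w ((S, ∅) :: h) i := by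
  have : empAvail ((S, A) :: h) = empAvail ((S, ∅) :: h) := by
    ext j; simp [empAvail, List.countP_cons]
  simp only [jointEst, this]

theorem pathSum_sum_mul {N : ℕ} {ι : Type*} [Fintype ι] (c : ι → ℝ)
    (g : ι → History N → Round N → ℝ) (h : History N) :
    pathSum (fun h r => ∑ j, c j * g j h r) h = ∑ j, c j * pathSum (g j) h := by
  induction h with
  | nil => simp [pathSum]
  | cons r h ih => simp only [pathSum, ih, mul_add, Finset.sum_add_distrib]

section

variable {N k T : ℕ} {mix : MixtureRule N k} {lam : ℕ → ℝ} {eta : ℝ} {a : Fin N → ℝ}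
  {loss : ℕ → Fin N → ℝ}

theorem jointEst_nonneg (hk : 1 ≤ k) {w : Fin N → ℝ} (hw : ∀ i, 0 < w i) (h : History N)
    (i : Fin N) : 0 ≤ jointEst k w h i :=
  Finset.sum_nonneg fun S _ => mul_nonneg (availProb_nonneg (empAvail_mem_Icc h) S)
    (scaledProb_mem_Icc hk S hw i).1

theorem estLoss_nonneg (hk : 1 ≤ k)
    (hloss : ∀ t, 1 ≤ t → t ≤ T → ∀ i, 0 ≤ loss t i ∧ loss t i ≤ 1)
    (hlam : ∀ t, 1 ≤ t → t ≤ T → 0 < lam t ∧ lam t ≤ 1) (h : History N) (r : Round N)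
    (i : Fin N) (hh : h.length < T) :
    0 ≤ estLoss k lam loss (weights k lam eta loss h) r h i := by
  rw [estLoss]
  split_ifs
  · exact div_nonneg (hloss _ (by omega) (by omega) i).1
      (add_nonneg (jointEst_nonneg hk (weights_pos lam eta loss h) _ i)
        (hlam _ (by omega) (by omega)).1.le)
  · exact le_rfl

/-- The increment is linear in the scaled probabilities and the comparator, and the estimates do not
depend on the virtual set `S`. So it is the average over `S` of the increments bounded in
`pathSum_regret_le`. -/
theorem pathSum_estRegretIncr_le (hk : 1 ≤ k) (hkN : k ≤ N) (heta : 0 < eta)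
    (ha : ∀ i, 0 ≤ a i ∧ a i ≤ 1)
    (hloss : ∀ t, 1 ≤ t → t ≤ T → ∀ i, 0 ≤ loss t i ∧ loss t i ≤ 1)
    (hlam : ∀ t, 1 ≤ t → t ≤ T → 0 < lam t ∧ lam t ≤ 1) (π : Policy N k) (h : History N)
    (hT : h.length ≤ T) :
    pathSum (estRegretIncr k lam eta a loss π.1) h ≤ k * Real.log (N / k) / eta := by
  have h1 : estRegretIncr k lam eta a loss π.1 = fun h r => ∑ S, availProb a S *
      ∑ i, ((scaledProb k S (weights k lam eta loss h) i - if i ∈ π.1 S then 1 else 0) *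
            estLoss k lam loss (weights k lam eta loss h) r h i -
          eta * (scaledProb k S (weights k lam eta loss h) i *
            estLoss k lam loss (weights k lam eta loss h) r h i ^ 2)) := by
    funext h r
    simp_rw [estRegretIncr, jointProb, policyProb, Finset.mul_sum]
    rw [Finset.sum_comm]
    refine Finset.sum_congr rfl fun i _ => ?_
    rw [← Finset.sum_sub_distrib, Finset.sum_mul, Finset.sum_mul, Finset.mul_sum,
      ← Finset.sum_sub_distrib]
    exact Finset.sum_congr rfl fun S _ => by ring
  rw [h1, pathSum_sum_mul]
  calc _ ≤ ∑ S, availProb a S * (k * Real.log (N / k) / eta) :=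
        Finset.sum_le_sum fun S _ => mul_le_mul_of_nonneg_left
          (pathSum_regret_le hk hkN heta
            (fun h r i hh => estLoss_nonneg hk hloss hlam h r i hh)
            (π.2 S).1 (π.2 S).2 h hT) (availProb_nonneg ha S)
    _ = _ := by rw [← Finset.sum_mul, sum_availProb, one_mul]

theorem stepExp_excess (hk : 1 ≤ k) {w : Fin N → ℝ} (hw : ∀ i, 0 < w i) (ℓ : Fin N → ℝ)
    (π : Finset (Fin N) → Finset (Fin N)) :
    stepExp mix a w (fun r => ∑ i ∈ r.2, ℓ i - ∑ i ∈ π r.1, ℓ i) =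
      ∑ i, (jointProb k a w i - policyProb a π i) * ℓ i := by
  have h1 : ∀ r : Round N, ∑ i ∈ r.2, ℓ i - ∑ i ∈ π r.1, ℓ i =
      ∑ i, ((if i ∈ r.2 then ℓ i else 0) + -1 * (if i ∈ π r.1 then ℓ i else 0)) := by
    intro r
    rw [Finset.sum_add_distrib, ← Finset.mul_sum]
    simp [sub_eq_add_neg]
  simp_rw [h1]
  rw [stepExp_sum]
  refine Finset.sum_congr rfl fun i _ => ?_
  rw [stepExp_add, stepExp_const_mul, stepExp_ite_mem hk hw i fun _ => ℓ i,
    stepExp_fst hk hw fun S => if i ∈ π S then ℓ i else 0, jointProb, policyProb, sub_mul,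
    Finset.sum_mul, Finset.sum_mul, neg_one_mul, ← sub_eq_add_neg]
  congr 1
  · exact Finset.sum_congr rfl fun S _ => by ring
  · exact Finset.sum_congr rfl fun S _ => by split_ifs <;> ring

/-- Apply `estimate_bias_variance` to each arm, conditionally on the history. Off the bad event its
accuracy hypothesis holds because the plug-in estimate and its target are means of the same
`[0,1]`-valued function under two availability laws. -/
theorem stepExp_excess_le (hk : 1 ≤ k) (heta : 0 ≤ eta ∧ eta ≤ 1) (ha : ∀ i, 0 ≤ a i ∧ a i ≤ 1)
    (hloss : ∀ t, 1 ≤ t → t ≤ T → ∀ i, 0 ≤ loss t i ∧ loss t i ≤ 1)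
    (hlam : ∀ t, 1 ≤ t → t ≤ T → 0 < lam t ∧ lam t ≤ 1) (π : Finset (Fin N) → Finset (Fin N))
    (h : History N) (hT : h.length < T) :
    stepExp mix a (weights k lam eta loss h)
        (fun r => ∑ i ∈ r.2, loss (h.length + 1) i - ∑ i ∈ π r.1, loss (h.length + 1) i) ≤
      stepExp mix a (weights k lam eta loss h) (estRegretIncr k lam eta a loss π h) +
        N * (2 * lam (h.length + 1) + eta + 3 / lam (h.length + 1) ^ 2 *
          stepExp mix a (weights k lam eta loss h) fun r => badInd lam a (r :: h)) := by
  set w := weights k lam eta loss h with hw'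
  have hw : ∀ i, 0 < w i := weights_pos lam eta loss h
  set t := h.length + 1 with ht
  have hb : stepExp mix a w (fun r => badInd lam a (r :: h)) =
      ∑ S, availProb a S * badInd lam a ((S, ∅) :: h) := by
    rw [← stepExp_fst (mix := mix) hk hw fun S => badInd lam a ((S, ∅) :: h)]
    rfl
  have hG : stepExp mix a w (estRegretIncr k lam eta a loss π h) =
      ∑ i, ((jointProb k a w i - policyProb a π i) * (∑ S, availProb a S *
          (scaledProb k S w i * (loss t i / (jointEst k w ((S, ∅) :: h) i + lam t)))) -
        eta * (jointProb k a w i * ∑ S, availProb a S *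
          (scaledProb k S w i * (loss t i / (jointEst k w ((S, ∅) :: h) i + lam t)) ^ 2))) := by
    have h1 : estRegretIncr k lam eta a loss π h = fun r => ∑ i,
        ((jointProb k a w i - policyProb a π i) * (if i ∈ r.2 then
          loss t i / (jointEst k w ((r.1, ∅) :: h) i + lam t) else 0) +
        -(eta * jointProb k a w i) * (if i ∈ r.2 then
          (loss t i / (jointEst k w ((r.1, ∅) :: h) i + lam t)) ^ 2 else 0)) := by
      funext r
      refine Finset.sum_congr rfl fun i _ => ?_
      rw [estLoss, ← hw', ← ht, show r :: h = (r.1, r.2) :: h from rfl, jointEst_cons_congr]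
      split_ifs <;> ring
    rw [h1, stepExp_sum]
    refine Finset.sum_congr rfl fun i _ => ?_
    rw [stepExp_add, stepExp_const_mul, stepExp_const_mul,
      stepExp_ite_mem hk hw i fun S => loss t i / (jointEst k w ((S, ∅) :: h) i + lam t),
      stepExp_ite_mem hk hw i fun S => (loss t i / (jointEst k w ((S, ∅) :: h) i + lam t)) ^ 2]
    ring
  have hN : ∀ c : ℝ, N * c = ∑ _i : Fin N, c := fun c => by simp
  rw [stepExp_excess hk hw, hG, hb, hN, ← Finset.sum_add_distrib]
  refine Finset.sum_le_sum fun i _ => ?_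
  refine estimate_bias_variance (availProb_nonneg ha) (sum_availProb a)
    (fun S => scaledProb_mem_Icc hk S hw i) (fun S => jointEst_nonneg hk hw _ i) (fun S => ?_)
    rfl (sum_availProb_mul_mem_Icc ha fun S => by split_ifs <;> norm_num)
    (hloss t (by omega) (by omega) i) (hlam t (by omega) (by omega)) heta
  rw [badInd]
  by_cases hbad : IsBad lam a ((S, ∅) :: h)
  · left; rw [if_pos hbad]
  · right
    refine ⟨if_neg hbad, ?_⟩
    rw [IsBad, not_lt] at hbad
    exact (abs_sum_availProb_sub_le (empAvail_mem_Icc _) ha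
      fun S => scaledProb_mem_Icc hk S hw i).trans hbad

theorem expectation_excessLoss (hk : 1 ≤ k) (π : Finset (Fin N) → Finset (Fin N)) (T : ℕ) :
    expectation mix lam eta a loss T (excessLoss loss π) = ∑ t ∈ Finset.range T,
      expectation mix lam eta a loss t fun h => stepExp mix a (weights k lam eta loss h)
        fun r => ∑ i ∈ r.2, loss (h.length + 1) i - ∑ i ∈ π r.1, loss (h.length + 1) i :=
  expectation_eq_sum hk rfl (fun _ _ => rfl) T

/-- The regret against a policy, for arbitrary positive learning rate and bias parameters. -/
theorem expectation_excessLoss_le (hk : 1 ≤ k) (hkN : k ≤ N) (heta : 0 < eta ∧ eta ≤ 1)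
    (ha : ∀ i, 0 ≤ a i ∧ a i ≤ 1)
    (hloss : ∀ t, 1 ≤ t → t ≤ T → ∀ i, 0 ≤ loss t i ∧ loss t i ≤ 1)
    (hlam : ∀ t, 1 ≤ t → t ≤ T → 0 < lam t ∧ lam t ≤ 1) (π : Policy N k) :
    expectation mix lam eta a loss T (excessLoss loss π.1) ≤
      k * Real.log (N / k) / eta + ∑ t ∈ Finset.range T, N * (2 * lam (t + 1) + eta +
        3 / lam (t + 1) ^ 2 * expectation mix lam eta a loss (t + 1) (badInd lam a)) := by
  have h1 : ∑ t ∈ Finset.range T, expectation mix lam eta a loss t (fun h =>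
      stepExp mix a (weights k lam eta loss h) (estRegretIncr k lam eta a loss π.1 h)) ≤
      k * Real.log (N / k) / eta := by
    rw [← expectation_eq_sum hk (F := pathSum (estRegretIncr k lam eta a loss π.1)) rfl
      (fun _ _ => rfl) T, ← expectation_const (mix := mix) (lam := lam) (eta := eta) (a := a)
        (loss := loss) hk T (k * Real.log (N / k) / eta)]
    exact expectation_mono hk ha fun h hh =>
      pathSum_estRegretIncr_le hk hkN heta.1 ha hloss hlam π h hh.le
  rw [expectation_excessLoss hk]
  refine le_trans ?_ (add_le_add h1 le_rfl)
  rw [← Finset.sum_add_distrib]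
  refine Finset.sum_le_sum fun t ht => ?_
  have htT : t < T := Finset.mem_range.mp ht
  calc _ ≤ expectation mix lam eta a loss t (fun h =>
        stepExp mix a (weights k lam eta loss h) (estRegretIncr k lam eta a loss π.1 h) +
          (N * (2 * lam (t + 1) + eta) + N * (3 / lam (t + 1) ^ 2) *
            stepExp mix a (weights k lam eta loss h) fun r => badInd lam a (r :: h))) := by
        refine expectation_mono hk ha fun h hh => ?_
        have := stepExp_excess_le (mix := mix) hk ⟨heta.1.le, heta.2⟩ ha hloss hlam π.1 h
          (by omega)
        rw [hh] at this ⊢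
        refine this.trans_eq ?_
        ring
    _ = _ := by
        rw [expectation_add, expectation_add, expectation_const hk, expectation_const_mul,
          expectation_succ]
        ring

/-- If all arms can be played at once, there is no regret. -/
theorem expectation_excessLoss_of_le (hk : 1 ≤ k) (hNk : N ≤ k) (π : Policy N k) :
    expectation mix lam eta a loss T (excessLoss loss π.1) = 0 := by
  rw [expectation_excessLoss hk]
  refine Finset.sum_eq_zero fun t _ => ?_
  rw [← expectation_const (mix := mix) (lam := lam) (eta := eta) (a := a) (loss := loss) hk t 0]
  refine expectation_congr fun h _ => ?_
  have hw : ∀ i, 0 < weights k lam eta loss h i := weights_pos lam eta loss h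
  rw [stepExp_excess hk hw]
  refine Finset.sum_eq_zero fun i _ => ?_
  have : jointProb k a (weights k lam eta loss h) i = policyProb a π.1 i := by
    refine Finset.sum_congr rfl fun S _ => ?_
    have hS : S.card ≤ k := by
      have := S.card_le_univ
      simp at this; omega
    have hπ : π.1 S = S :=
      Finset.eq_of_subset_of_card_le (π.2 S).1 (by rw [(π.2 S).2]; omega)
    rw [scaledProb_of_card_le hk hS hw, hπ]
  rw [this, sub_self, zero_mul]

end

/-! ### Tuning -/

/-- Telescoping: if `x² - y² = 1` and `x > 0`, then `1 / x ≤ 2 (x - y)` amounts to `(x - y)² ≥ 0`.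
-/
theorem sum_inv_sqrt_le (T : ℕ) :
    ∑ t ∈ Finset.range T, 1 / Real.sqrt ((t + 1 : ℕ) : ℝ) ≤ 2 * Real.sqrt T := by
  induction T with
  | zero => simp
  | succ T ih =>
    rw [Finset.sum_range_succ]
    have hx : 0 < Real.sqrt ((T + 1 : ℕ) : ℝ) := Real.sqrt_pos.mpr (by positivity)
    have hx2 : Real.sqrt ((T + 1 : ℕ) : ℝ) ^ 2 = T + 1 := by
      rw [Real.sq_sqrt (by positivity)]; push_cast; ring
    have hy2 : Real.sqrt (T : ℝ) ^ 2 = T := Real.sq_sqrt (by positivity)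
    set x := Real.sqrt ((T + 1 : ℕ) : ℝ)
    set y := Real.sqrt (T : ℝ)
    have : 1 / x ≤ 2 * x - 2 * y := by
      rw [div_le_iff₀ hx]
      nlinarith [sq_nonneg (x - y)]
    linarith

/-- Properties of the bias parameter; `y ^ 2` is `log T / t`. -/
theorem biasParam_spec {M y lam : ℝ} (hM : 1 ≤ M) (hy : 0 < y)
    (hlam : lam = min 1 (4 * M * y + 16 / 3 * M * y ^ 2)) :
    0 < lam ∧ lam ≤ 1 ∧ lam ≤ 10 * M * y ∧ min 1 (4 * y) ≤ lam ∧
      (lam < 1 → 4 * M * y ≤ lam) := by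
  have hMy : y ≤ M * y := le_mul_of_one_le_left hy.le hM
  have h2 : 0 ≤ 16 / 3 * M * y ^ 2 := by positivity
  refine ⟨hlam ▸ lt_min one_pos (by positivity), hlam ▸ min_le_left _ _, ?_, ?_, fun h => ?_⟩
  · rw [hlam]
    rcases le_total y 1 with h | h
    · refine (min_le_right _ _).trans ?_
      have : M * y ^ 2 ≤ M * y := by
        rw [sq, ← mul_assoc]; exact mul_le_of_le_one_right (by linarith) h
      linarith
    · exact (min_le_left _ _).trans (by linarith)
  · rw [hlam]
    exact min_le_min le_rfl (by linarith)
  · rw [hlam] at h ⊢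
    rcases min_lt_iff.mp h with h | h
    · exact absurd h (lt_irrefl _)
    · rw [min_eq_right h.le]; linarith

/-- In units of the target rate, the bias costs `40`, the entropy `2`, the second-order term `2` and
the bad events `12`. The assumption `k < N` makes `eta` positive. -/
theorem regret_le_of_lt {N k T : ℕ} (hk : 1 ≤ k) (hkN : k < N) (hT : 2 ≤ T) {a : Fin N → ℝ}
    (ha : ∀ i, 0 ≤ a i ∧ a i ≤ 1) {loss : ℕ → Fin N → ℝ}
    (hloss : ∀ t, 1 ≤ t → t ≤ T → ∀ i, 0 ≤ loss t i ∧ loss t i ≤ 1)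
    (mix : MixtureRule N k) {eta : ℝ} {lam : ℕ → ℝ}
    (heta : eta = Real.sqrt (Real.log ((N : ℝ) / k) / (N * T)))
    (hlam : ∀ t : ℕ, 1 ≤ t → t ≤ T →
      lam t = min 1 (4 * (k * N) * Real.sqrt (Real.log T / t) +
        16 / 3 * (k * N) * Real.sqrt (Real.log T / t) ^ 2)) (π : Policy N k) :
    expectation mix lam eta a loss T (excessLoss loss π.1) ≤
      60 * (k * (N : ℝ) ^ 2 * Real.sqrt (T * Real.log T)) := by
  have hk1 : (1 : ℝ) ≤ k := by exact_mod_cast hk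
  have hk0 : (0 : ℝ) < k := by linarith
  have hN1 : (1 : ℝ) ≤ N := by exact_mod_cast (by omega : 1 ≤ N)
  have hN0 : (0 : ℝ) < N := by linarith
  have hT2 : (2 : ℝ) ≤ T := by exact_mod_cast hT
  have hT0 : (0 : ℝ) < T := by linarith
  have hL : 1 / 2 ≤ Real.log T :=
    le_trans (by linarith [Real.log_two_gt_d9]) (Real.log_le_log two_pos hT2)
  set L := Real.log T with hLdef
  have hM : (1 : ℝ) ≤ k * N := one_le_mul_of_one_le_of_one_le hk1 hN1
  -- the learning rate
  have hΛ0 : 0 < Real.log ((N : ℝ) / k) :=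
    Real.log_pos (by rw [lt_div_iff₀ hk0, one_mul]; exact_mod_cast hkN)
  have hΛN : Real.log ((N : ℝ) / k) ≤ N :=
    (Real.log_le_self (by positivity)).trans (div_le_self hN0.le hk1)
  have heta0 : 0 < eta := heta ▸ Real.sqrt_pos.mpr (by positivity)
  have heta2 : eta ^ 2 = Real.log ((N : ℝ) / k) / (N * T) := by
    rw [heta, Real.sq_sqrt (by positivity)]
  have hetaT : eta * Real.sqrt T ≤ 1 := by
    rw [← abs_of_nonneg (by positivity : 0 ≤ eta * Real.sqrt T), ← sq_le_one_iff_abs_le_one,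
      mul_pow, heta2, Real.sq_sqrt hT0.le,
      show Real.log ((N : ℝ) / k) / (N * T) * T = Real.log ((N : ℝ) / k) / N by field_simp,
      div_le_one hN0]
    exact hΛN
  have hsT : Real.sqrt T ^ 2 = T := Real.sq_sqrt hT0.le
  have hsT1 : 1 ≤ Real.sqrt T := by rw [Real.one_le_sqrt]; linarith
  have heta1 : eta ≤ 1 := le_trans (le_mul_of_one_le_right heta0.le hsT1) hetaT
  have hetaT' : eta * T ≤ Real.sqrt T := by
    calc eta * T = eta * Real.sqrt T * Real.sqrt T := by rw [mul_assoc, ← sq, hsT]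
      _ ≤ 1 * Real.sqrt T := by gcongr
      _ = _ := one_mul _
  -- the bias parameters
  have hy : ∀ t : ℕ, 1 ≤ t → 0 < Real.sqrt (L / t) := fun t ht =>
    Real.sqrt_pos.mpr (div_pos (by linarith) (by exact_mod_cast ht))
  have hspec := fun t h1 h2 => biasParam_spec hM (hy t h1) (hlam t h1 h2)
  have hmain := expectation_excessLoss_le (mix := mix) hk hkN.le ⟨heta0, heta1⟩ ha hloss
    (fun t h1 h2 => ⟨(hspec t h1 h2).1, (hspec t h1 h2).2.1⟩) π
  have hterm : ∀ t ∈ Finset.range T, (N : ℝ) * (2 * lam (t + 1) + eta + 3 / lam (t + 1) ^ 2 *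
      expectation mix lam eta a loss (t + 1) (badInd lam a)) ≤
      20 * k * N ^ 2 * Real.sqrt L * (1 / Real.sqrt ((t + 1 : ℕ) : ℝ)) + (N * eta +
        6 * N ^ 2 / T) := by
    intro t ht
    have ht1 : 1 ≤ t + 1 := by omega
    have htT : t + 1 ≤ T := Finset.mem_range.mp ht
    obtain ⟨hl0, hl1, hl2, hl3, hl4⟩ := hspec (t + 1) ht1 htT
    have hyt := hy (t + 1) ht1
    have hsq : Real.sqrt (L / (t + 1 : ℕ)) ^ 2 = L / (t + 1 : ℕ) :=
      Real.sq_sqrt (div_nonneg (by linarith) (by positivity))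
    have hsqrt : Real.sqrt (L / (t + 1 : ℕ)) =
        Real.sqrt L * (1 / Real.sqrt ((t + 1 : ℕ) : ℝ)) := by
      rw [Real.sqrt_div (by linarith)]; ring
    have htT' : ((t + 1 : ℕ) : ℝ) ≤ T := by exact_mod_cast htT
    have htpos : (0 : ℝ) < ((t + 1 : ℕ) : ℝ) := by positivity
    set y := Real.sqrt (L / (t + 1 : ℕ)) with hydef
    -- With `ε = 4 * y` the exponent is `-4 log T`, so a bad round has probability at most `2 * N /
    -- T ^ 4`.
    have hβ := expectation_badInd_le (mix := mix) (lam := lam) (eta := eta) (loss := loss) hk ha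
      ht1 (ε := 4 * y) (by positivity) (fun h => le_trans (by
        have : N * y ≤ k * (N * y) := le_mul_of_one_le_left (by positivity) hk1
        linarith) (hl4 h))
    have hexp : Real.exp (-((t + 1 : ℕ) * (4 * y) ^ 2 / 4)) = 1 / (T : ℝ) ^ 4 := by
      rw [mul_pow, hsq, show -((t + 1 : ℕ) * (4 ^ 2 * (L / (t + 1 : ℕ))) / 4) =
        -((4 : ℕ) * L) by field_simp; norm_num, Real.exp_neg, Real.exp_nat_mul, hLdef,
        Real.exp_log hT0, one_div]
    rw [hexp] at hβ
    -- Either `lam` is `1`, or its square is at least `16 L / (t + 1)`, which exceeds `1 / T`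
    -- because `L ≥ 1 / 2`.
    have hlT : 1 / lam (t + 1) ^ 2 ≤ T := by
      rw [div_le_iff₀ (by positivity)]
      have h1 : 1 / T ≤ (min 1 (4 * y)) ^ 2 := by
        rcases min_choice 1 (4 * y) with h | h <;> rw [h]
        · rw [one_pow, div_le_one hT0]; linarith
        · rw [mul_pow, hsq]
          calc 1 / (T : ℝ) ≤ 1 / ((t + 1 : ℕ) : ℝ) := by gcongr
            _ ≤ (4 ^ 2 * L) / ((t + 1 : ℕ) : ℝ) := by gcongr; linarith
            _ = _ := by ring
      have h2 : (min 1 (4 * y)) ^ 2 ≤ lam (t + 1) ^ 2 :=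
        pow_le_pow_left₀ (le_min zero_le_one (by positivity)) hl3 2
      calc (1 : ℝ) = T * (1 / T) := by field_simp
        _ ≤ T * lam (t + 1) ^ 2 := by gcongr; exact h1.trans h2
    have hbad : 3 / lam (t + 1) ^ 2 * expectation mix lam eta a loss (t + 1) (badInd lam a) ≤
        6 * N / T := by
      calc _ ≤ 3 / lam (t + 1) ^ 2 * (2 * N * (1 / (T : ℝ) ^ 4)) := by gcongr
        _ = (1 / lam (t + 1) ^ 2) * (6 * N / (T : ℝ) ^ 4) := by ring
        _ ≤ T * (6 * N / (T : ℝ) ^ 4) := by gcongr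
        _ = 6 * N / (T : ℝ) ^ 3 := by field_simp
        _ ≤ 6 * N / (T : ℝ) := by
            gcongr
            exact le_self_pow₀ (by linarith) (by norm_num)
    calc _ ≤ (N : ℝ) * (2 * (10 * (k * N) * y) + eta + 6 * N / T) := by gcongr
      _ = _ := by rw [hsqrt]; ring
  have hsum := Finset.sum_le_sum hterm
  rw [Finset.sum_add_distrib, Finset.sum_const, Finset.card_range,
    nsmul_eq_mul] at hsum
  have hs := mul_le_mul_of_nonneg_left (sum_inv_sqrt_le T)
    (by positivity : 0 ≤ 20 * k * (N : ℝ) ^ 2 * Real.sqrt L)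
  -- The choice of `eta` gives `log (N / k) = eta ^ 2 * N * T`.
  have hK : k * Real.log (N / k) / eta = k * (N * (eta * T)) := by
    have : Real.log ((N : ℝ) / k) = eta ^ 2 * (N * T) := by rw [heta2]; field_simp
    rw [this]; field_simp
  have hX : Real.sqrt (T * L) = Real.sqrt T * Real.sqrt L := Real.sqrt_mul hT0.le L
  have hsL : 1 / 2 ≤ Real.sqrt L := Real.le_sqrt_of_sq_le (by linarith)
  have hTX : Real.sqrt T ≤ 2 * Real.sqrt (T * L) := by
    rw [hX]
    have : Real.sqrt T * (1 / 2) ≤ Real.sqrt T * Real.sqrt L := by gcongr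
    linarith
  have hB : (N : ℝ) ≤ k * N ^ 2 := by
    calc (N : ℝ) = 1 * N ^ 1 := by ring
      _ ≤ k * N ^ 2 := by gcongr; norm_num
  have h1 : k * (N * (eta * T)) ≤ 2 * (k * (N : ℝ) ^ 2 * Real.sqrt (T * L)) := by
    calc k * (N * (eta * T)) ≤ k * (N ^ 2 * (2 * Real.sqrt (T * L))) := by
          have hNN : (N : ℝ) ≤ N ^ 2 := le_self_pow₀ hN1 two_ne_zero
          exact mul_le_mul_of_nonneg_left
            (mul_le_mul hNN (hetaT'.trans hTX) (by positivity) (by positivity)) hk0.le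
      _ = _ := by ring
  have h2 : T * (N * eta) ≤ 2 * (k * (N : ℝ) ^ 2 * Real.sqrt (T * L)) := by
    calc T * (N * eta) = N * (eta * T) := by ring
      _ ≤ k * N ^ 2 * (2 * Real.sqrt (T * L)) :=
          mul_le_mul hB (hetaT'.trans hTX) (by positivity) (by positivity)
      _ = _ := by ring
  have h3 : T * (6 * (N : ℝ) ^ 2 / T) ≤ 12 * (k * (N : ℝ) ^ 2 * Real.sqrt (T * L)) := by
    calc T * (6 * (N : ℝ) ^ 2 / T) = 6 * (1 * (N : ℝ) ^ 2 * 1) := by field_simp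
      _ ≤ 6 * (k * (N : ℝ) ^ 2 * (2 * Real.sqrt (T * L))) := by
          gcongr; exact hsT1.trans hTX
      _ = _ := by ring
  have h4 : 20 * k * (N : ℝ) ^ 2 * Real.sqrt L * (2 * Real.sqrt T) =
      40 * (k * (N : ℝ) ^ 2 * Real.sqrt (T * L)) := by rw [hX]; ring
  have h5 : 0 ≤ k * (N : ℝ) ^ 2 * Real.sqrt (T * L) := by positivity
  rw [hK] at hmain
  rw [h4, Finset.mul_sum] at hs
  linarith

end SleepingBandit

theorem theorem1 :
    ∃ C : ℝ, 0 < C ∧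
      ∀ (N k T : ℕ), 1 ≤ k → k ≤ N → 2 ≤ T →
      ∀ (a : Fin N → ℝ), (∀ i, 0 ≤ a i ∧ a i ≤ 1) →
      ∀ (loss : ℕ → Fin N → ℝ), (∀ t, 1 ≤ t → t ≤ T → ∀ i, 0 ≤ loss t i ∧ loss t i ≤ 1) →
      ∀ (mix : SleepingBandit.MixtureRule N k) (δ eta : ℝ) (lam : ℕ → ℝ),
        δ = (N : ℝ) / (T : ℝ) ^ 2 →
        eta = Real.sqrt (Real.log ((N : ℝ) / k) / (N * T)) →
        (∀ t : ℕ, 1 ≤ t → t ≤ T →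
          lam t = min 1 (2 * k * N * Real.sqrt (2 * Real.log (N / δ) / t) +
            8 * k * N * Real.log (N / δ) / (3 * t))) →
        SleepingBandit.regret mix lam eta a loss T ≤
          C * (k * (N : ℝ) ^ 2 * Real.sqrt (T * Real.log T)) := by
  refine ⟨60, by norm_num, ?_⟩
  intro N k T hk hkN hT a ha loss hloss mix δ eta lam hδ heta hlam
  have hB : 0 ≤ 60 * (k * (N : ℝ) ^ 2 * Real.sqrt (T * Real.log T)) := by positivity
  -- Nonnegativity of the bound is needed since a real supremum over an empty index type is `0`.
  refine Real.iSup_le (fun π => ?_) hB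
  -- For `k = N` the learning rate is `0` and the general bound does not apply, but then learner and
  -- policy both play every available arm.
  rcases hkN.lt_or_eq with hlt | heq
  swap
  · rw [SleepingBandit.expectation_excessLoss_of_le hk heq.ge]
    exact hB
  refine SleepingBandit.regret_le_of_lt hk hlt hT ha hloss mix heta (fun t h1 h2 => ?_) π
  have hN0 : (N : ℝ) ≠ 0 := by exact_mod_cast (by omega : N ≠ 0)
  have hT0 : (T : ℝ) ≠ 0 := by exact_mod_cast (by omega : T ≠ 0)
  have ht0 : (0 : ℝ) < t := by exact_mod_cast h1
  have hL : 0 ≤ Real.log T := Real.log_natCast_nonneg T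
  -- As `N / δ = T ^ 2`, the coefficients `2` and `8 / 3` of `lam` become `4` and `16 / 3` in terms
  -- of `log T / t`.
  have hNδ : Real.log (N / δ) = 2 * Real.log T := by
    rw [hδ, show (N : ℝ) / (N / (T : ℝ) ^ 2) = (T : ℝ) ^ 2 by field_simp, Real.log_pow]
    norm_num
  have hs : Real.sqrt (2 * (2 * Real.log T) / t) = 2 * Real.sqrt (Real.log T / t) := by
    rw [show 2 * (2 * Real.log T) / t = 2 ^ 2 * (Real.log T / t) by ring,
      Real.sqrt_mul (by norm_num), Real.sqrt_sq (by norm_num)]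
  rw [hlam t h1 h2, hNδ, hs, Real.sq_sqrt (by positivity)]
  congr 1
  field_simp
  ring
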